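/- Consider an open Markovian multi-class queueing network (McQN): finitely many stations and classes $k=1,\dots,d$, class $k$ being served at a station $\mathfrak S(k)$ ($\mathfrak S$ surjective) at exponential rate $\beta_k>0$; routing probabilities $R_{kl}\ge 0$ with $R_{k0}=1-\sum_l R_{kl}\ge 0$ and $(I-R')^{-1}=\sum_{n\ge 0}(R')^n$; any non-idling service/queue policy, encoded at each station by a countable set of queue configurations with insertion and deletion operators and with the fractions of service capacity allocated to the classes. External arrivals are independent Poisson processes with rates $\theta v_k$, where $v\ge 0$, $v\neq 0$ is a fixed direction and $\theta\ge 0$. Under $\mathbb P_\theta$ let $X=(X_t)_{t\ge0}$ be the resulting continuous-time Markov chain of network configurations (a countable state space $\mathbb X$), started empty. Let $\Theta_s$ be the set of $\theta\ge 0$ for which the network is stable (positive recurrent), $\theta_*=\sup\Theta_s$, and let $\bar\theta=\min_i\delta_i$ with $\delta_i=\big(\sum_{k:\mathfrak S(k)=i}[(I-R')^{-1}v]_k/\beta_k\big)^{-1}$ (equal to $+\infty$ if the sum is $0$) be the sub-critical threshold. Assume that the network is stochastically monotone: there is a bounded $\phi:\mathbb X\to\mathbb R$ vanishing at infinity such that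 $(t,\theta)\mapsto\varphi_t(\theta)=\mathbb E_\theta[\phi(X_t)]$ is non-increasing in both arguments on $[0,\infty)^2$, and $\varphi=\lim_{t\to\infty}\varphi_t$ is continuous and strictly decreasing on $\Theta_s$. Let $\varepsilon>0$ be such that $\varphi(\theta)=\varepsilon$ has a root $\theta_\varepsilon\ge 0$. Let $\vartheta_1\in\Theta_s$, and let $(b_n)_{n\ge1}$, $(t_n)_{n\ge1}$ be positive sequences with $t_n\to\infty$, $\sum_n b_n=\infty$ and $\sum_n b_n^2<\infty$. Let $$\vartheta_{n+1}=\min\{\bar\theta,\max\{\vartheta_n+b_n(Z_n-\varepsilon),0\}\},\qquad n\ge 1,$$ where the conditional law of $Z_n$ given $\vartheta_1,\dots,\vartheta_n$ is the law of $\phi(X_{t_n})$ under $\mathbb P_{\vartheta_n}$. Then $\vartheta_n\to\theta_\varepsilon$ almost surely. Assume furthermore that $\theta_\varepsilon<\theta_*$, that the derivatives $\varphi_t'$ converge uniformly on $(0,\theta_*)$ as $t\to\infty$, and that $\inf_{\theta\in(0,\theta_*)}|\varphi'(\theta)|>0$. If $b_n=c/n^\omega$ with $\omega\in(1/2,1]$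 and $c>(\omega-1/2)/\inf_{\theta\in(0,\theta_*)}|\varphi'(\theta)|$, and if $\sup_{\theta\in[0,\theta_*]}|\varphi_{t_n}(\theta)-\varphi(\theta)|=o(n^{-\kappa})$ for some $\kappa>\omega-1/2$, then $\vartheta_n-\theta_\varepsilon=O(n^{-(\omega-1/2)})$ in probability, i.e. for every $\eta>0$ there is $M$ with $\mathbb P\{|\vartheta_n-\theta_\varepsilon|>Mn^{-(\omega-1/2)}\}\le\eta$ for all $n\ge 1$. -/

import Mathlib

open MeasureTheory ProbabilityTheory Filter Topology
open scoped NNReal ENNReal Matrix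

noncomputable section

/-- An open Markovian multi-class queueing network with `s` stations and `d` job classes, without
its external arrival rates. The service and queue policies are encoded, station by station, by a
countable set of queue configurations together with insertion and deletion operators and the
fractions of service capacity allocated to the classes in a given configuration. -/
structure McQN (s d : ℕ) where
  /-- the station that serves a class -/
  station : Fin d → Fin s
  station_surj : Function.Surjective station
  /-- the exponential service rates -/
  β : Fin d → ℝ≥0
  β_pos : ∀ k, 0 < β k
  /-- the routing matrix -/
  R : Matrix (Fin d) (Fin d) ℝ≥0
  R_row_le : ∀ k, ∑ l, R k l ≤ 1
  /-- the network is open: `(I - R')⁻¹ = I + R' + R'² + …` -/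
  R_open : HasSum (fun n : ℕ => ((R.map NNReal.toReal)ᵀ) ^ n) (1 - (R.map NNReal.toReal)ᵀ)⁻¹
  /-- the queue configurations at a station -/
  Conf : Fin s → Type
  conf_countable : ∀ i, Countable (Conf i)
  /-- the empty queue -/
  empty : ∀ i, Conf i
  /-- the number of jobs of each class present at a station (waiting or in service) -/
  count : ∀ i, Conf i → Fin d → ℕ
  count_of_ne : ∀ i p k, station k ≠ i → count i p k = 0
  count_eq_zero_iff : ∀ i p, count i p = 0 ↔ p = empty i
  /-- the fraction of the capacity of station `i` that is allocated to class `k` -/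
  W : ∀ i, Conf i → Fin d → ℝ≥0
  /-- only classes that are present receive service -/
  count_pos_of_W_pos : ∀ i p k, 0 < W i p k → 0 < count i p k
  /-- non-idling: a server with a non-empty queue uses its full capacity -/
  W_sum : ∀ i p, p ≠ empty i → ∑ k, W i p k = 1
  /-- a job of class `k` joins the queue at station `i`; used for `i = station k` only -/
  insert : ∀ i, Fin d → Conf i → Conf i
  count_insert : ∀ i k p, station k = i → count i (insert i k p) = count i p + Pi.single k 1
  /-- the job of class `k` in service leaves the queue; used for `i = station k` only -/
  delete : ∀ i, Fin d → Conf i → Conf i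
  count_delete : ∀ i k p, station k = i → 0 < W i p k →
    count i (delete i k p) + Pi.single k 1 = count i p

namespace McQN

variable {s d : ℕ} (N : McQN s d)

/-- The state space: one queue configuration for each station. It is countable and carries the
discrete `σ`-algebra. -/
def State : Type := ∀ i, N.Conf i

instance : MeasurableSpace N.State := ⊤

/-- The empty network. -/
def emptyState : N.State := fun i => N.empty i

/-- Probability that a job of class `k` turns into a job of class `l` (`some l`), or leaves the
network (`none`), after its service. -/
def route (k : Fin d) : Option (Fin d) → ℝ≥0
  | none => 1 - ∑ l, N.R k l
  | some l => N.R k l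

/-- Insertion of a job of class `k`. -/
def insertJob (k : Fin d) (ξ : N.State) : N.State :=
  Function.update ξ (N.station k) (N.insert (N.station k) k (ξ (N.station k)))

/-- Deletion of the job of class `k` in service. -/
def deleteJob (k : Fin d) (ξ : N.State) : N.State :=
  Function.update ξ (N.station k) (N.delete (N.station k) k (ξ (N.station k)))

/-- The rate of the transition `(k, l)` from the state `ξ` under the external arrival rates `a`;
`none` stands for the outside of the network. -/
def rate (a : Fin d → ℝ≥0) (ξ : N.State) : Option (Fin d) × Option (Fin d) → ℝ≥0
  | (none, none) => 0
  | (none, some l) => a l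
  | (some k, l) => N.W (N.station k) (ξ (N.station k)) k * N.β k * N.route k l

/-- The state reached from `ξ` by the transition `(k, l)`. -/
def target (ξ : N.State) : Option (Fin d) × Option (Fin d) → N.State
  | (none, none) => ξ
  | (none, some l) => N.insertJob l ξ
  | (some k, none) => N.deleteJob k ξ
  | (some k, some l) => N.insertJob l (N.deleteJob k ξ)

/-- A uniform bound for the total jump rates. -/
def unifRate (a : Fin d → ℝ≥0) : ℝ≥0 := ∑ k, a k + ∑ k, N.β k

lemma W_le_one (i : Fin s) (p : N.Conf i) (k : Fin d) : N.W i p k ≤ 1 := by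
  by_cases hp : p = N.empty i
  · by_contra h
    have h1 := N.count_pos_of_W_pos i p k (lt_trans one_pos (not_le.mp h))
    rw [(N.count_eq_zero_iff i p).mpr hp] at h1
    exact lt_irrefl _ h1
  · rw [← N.W_sum i p hp]
    exact Finset.single_le_sum (fun _ _ => zero_le) (Finset.mem_univ k)

lemma route_sum (k : Fin d) : ∑ l, N.route k l = 1 := by
  rw [Fintype.sum_option]
  exact tsub_add_cancel_of_le (N.R_row_le k)

lemma rate_sum_le (a : Fin d → ℝ≥0) (ξ : N.State) : ∑ τ, N.rate a ξ τ ≤ N.unifRate a := by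
  rw [Fintype.sum_prod_type, Fintype.sum_option, Fintype.sum_option]
  simp only [rate, zero_add, unifRate]
  gcongr with k _
  rw [← Finset.mul_sum, route_sum, mul_one]
  exact mul_le_of_le_one_left' (N.W_le_one _ _ _)

/-- The law of the next transition of the uniformized chain in the state `ξ`: the transition `τ`
has probability `rate τ / unifRate`, and with the remaining probability (`none`) nothing happens. -/
def stepChoice (a : Fin d → ℝ≥0) (ξ : N.State) :
    PMF (Option (Option (Fin d) × Option (Fin d))) :=
  PMF.ofFintype
    (fun o => ((o.elim (1 - (∑ τ, N.rate a ξ τ) / N.unifRate a)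
      (fun τ => N.rate a ξ τ / N.unifRate a) : ℝ≥0) : ℝ≥0∞))
    (by
      rw [← ENNReal.ofNNReal_finsetSum, ENNReal.coe_eq_one, Fintype.sum_option]
      simp only [Option.elim_none, Option.elim_some]
      rw [← Finset.sum_div]
      exact tsub_add_cancel_of_le (div_le_one_of_le₀ (N.rate_sum_le a ξ) zero_le))

/-- The one-step law of the uniformized chain. -/
def step (a : Fin d → ℝ≥0) (ξ : N.State) : PMF N.State :=
  (N.stepChoice a ξ).map (fun o => o.elim ξ (N.target ξ))

/-- The law at time `t` of the network process `X` with external arrival rates `a` and initial state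
`ξ`, i.e. of the continuous-time Markov chain on `N.State` with the transitions `target` at the
rates `rate`. As the total jump rates are bounded by `Λ = unifRate a`, one has `X_t = Y_{N_t}`, with
`Y` the chain with one-step law `step` and an independent Poisson process of rate `Λ`. -/
def trans (a : Fin d → ℝ≥0) (t : ℝ≥0) (ξ : N.State) : PMF N.State :=
  (poissonMeasure (N.unifRate a * t)).toPMF.bind
    (fun n => (fun μ : PMF N.State => μ.bind (N.step a))^[n] (PMF.pure ξ))

/-- Stability (positive recurrence): the network process has a stationary distribution. As the empty
state is accessible from every state, this is positive recurrence of the network started empty. -/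
def Stable (a : Fin d → ℝ≥0) : Prop :=
  ∃ π : PMF N.State, ∀ t : ℝ≥0, π.bind (N.trans a t) = π

/-- The vector of arrival rates `θ v` on the ray in direction `v` (for `θ ≥ 0`). -/
def ray (v : Fin d → ℝ≥0) (θ : ℝ) : Fin d → ℝ≥0 := fun k => θ.toNNReal * v k

/-- The stability set `Θ_s` along the ray. -/
def stableSet (v : Fin d → ℝ≥0) : Set ℝ := {θ | 0 ≤ θ ∧ N.Stable (ray v θ)}

/-- The stability threshold `θ_* = sup Θ_s`. -/
def threshold (v : Fin d → ℝ≥0) : ℝ := sSup (N.stableSet v)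

/-- The effective arrival rates `(I - R')⁻¹ v`. -/
def effRate (v : Fin d → ℝ≥0) : Fin d → ℝ :=
  (1 - (N.R.map NNReal.toReal)ᵀ)⁻¹ *ᵥ (fun k => (v k : ℝ))

/-- The traffic rate of station `i` under the arrival rates `v`. -/
def traffic (v : Fin d → ℝ≥0) (i : Fin s) : ℝ :=
  ∑ k with N.station k = i, N.effRate v k / N.β k

/-- The sub-critical threshold `min_i δ_i`, where `δ_i = 1 / traffic_i` (infinite for a station
without traffic), written as the inverse of `max_i traffic_i`. -/
def subcrit (v : Fin d → ℝ≥0) : ℝ := (⨆ i, N.traffic v i)⁻¹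

/-- The law of `X_t` under `P_θ`, for the network started empty. -/
def stateLaw (v : Fin d → ℝ≥0) (t θ : ℝ) : Measure N.State :=
  (N.trans (ray v θ) t.toNNReal N.emptyState).toMeasure

/-- The law of `φ(X_t)` under `P_θ`. -/
def valueLaw (v : Fin d → ℝ≥0) (φ : N.State → ℝ) (t θ : ℝ) : Measure ℝ :=
  (N.stateLaw v t θ).map φ

/-- `φ_t(θ) = E_θ[φ(X_t)]`. -/
def meanAt (v : Fin d → ℝ≥0) (φ : N.State → ℝ) (t θ : ℝ) : ℝ := ∫ ξ, φ ξ ∂(N.stateLaw v t θ)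

/-- The limit of `φ_t(θ)` for `t → ∞`. -/
def meanLim (v : Fin d → ℝ≥0) (φ : N.State → ℝ) (θ : ℝ) : ℝ :=
  limUnder atTop (fun t : ℝ => N.meanAt v φ t θ)

/-- The network is stochastically monotone (along the ray), as witnessed by `φ`. -/
structure IsStochMonotone (v : Fin d → ℝ≥0) (φ : N.State → ℝ) : Prop where
  bounded : ∃ C, ∀ ξ, |φ ξ| ≤ C
  vanish : Tendsto φ cofinite (𝓝 0)
  anti : ∀ t t' θ θ' : ℝ, 0 ≤ t → t ≤ t' → 0 ≤ θ → θ ≤ θ' → N.meanAt v φ t' θ' ≤ N.meanAt v φ t θ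
  cont : ContinuousOn (N.meanLim v φ) (N.stableSet v)
  strictAnti : StrictAntiOn (N.meanLim v φ) (N.stableSet v)

/-- The random sequence `ϑ_1, ϑ_2, …` is a sequence of projected Robbins–Monro iterates for `φ`, with
step sizes `b`, time horizons `t`, level `ε` and deterministic starting point `x`: given the history
`ϑ_1, …, ϑ_n`, the observation `Z_n` has the law of `φ(X_{t_n})` under `P_θ` at `θ = ϑ_n`. -/
structure IsScheme (v : Fin d → ℝ≥0) (φ : N.State → ℝ) (ε x : ℝ) (t b : ℕ → ℝ)
    {Ω : Type*} [mΩ : MeasurableSpace Ω] (P : Measure Ω) (ϑ Z : ℕ → Ω → ℝ) : Prop where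
  meas : ∀ n ≥ 1, Measurable (Z n)
  init : ∀ ω, ϑ 1 ω = x
  next : ∀ n ≥ 1, ∀ ω, ϑ (n + 1) ω = min (N.subcrit v) (max (ϑ n ω + b n * (Z n ω - ε)) 0)
  condLaw : ∀ n ≥ 1, ∀ A : Set ℝ, MeasurableSet A →
    P[(Z n ⁻¹' A).indicator (fun _ => (1 : ℝ)) |
        ⨆ j ∈ Finset.Icc 1 n, MeasurableSpace.comap (ϑ j) (borel ℝ)]
      =ᵐ[P] fun ω => (N.valueLaw v φ (t n) (ϑ n ω)).real A

end McQN

end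

/-! The convergence rests on monotonicity. Since φ_t decreases to φ as t grows, φ_{t_n} ≥ φ ≥ ε to
the left of the root θ_ε, so the bias of the observations only helps there. To the right of θ_ε + δ,
monotonicity in θ and convergence at the single point θ_ε + δ make the drift uniformly negative for
large n. Hence the squared distance of ϑ_n from [θ_ε, θ_ε + δ], corrected by the accumulated drift
and by the summable error b_n²C², is a supermartingale. It converges, and Σ b_n = ∞ forces the
distance to 0 (`IsProjectedRM.tendsto_root`). No condition linking b_n to t_n is needed.

Two facts about the network make this applicable. First, φ is assumed strictly decreasing on Θ_s
only, so one needs that φ(θ) > 0 implies stability (`stable_of_meanAt_ge`). One more step of the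
uniformized chain changes the law of X_t by O(t^{-1/2}), because a Poisson law with large mean
hardly changes under a shift by one. A function vanishing at infinity whose mean stays away from 0
keeps mass from escaping, so a limit of these laws is, after normalization, invariant. Second, ϑ_1
and θ_ε must lie in [0, θ̄], so that the projection never moves an iterate away from θ_ε. This is
`le_subcrit_of_mem_stableSet`: if a station is overloaded, its expected work V has positive drift in
every state, exp(-αV) contracts in the mean, and no stationary law can exist.

For the rate, the lower bound m on |φ'| gives (ϑ - θ_ε)(φ_{t_n}(ϑ) - ε) ≤ -m(ϑ - θ_ε)² + n^{-κ}|ϑ -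
θ_ε| as long as ϑ < θ_*. By the almost sure convergence, all late iterates are below θ_* with
probability close to 1. Localized to this event, the mean squared error satisfies a recursion of
Chung's type, hence is O(n^{-(2ω-1)}), and Markov's inequality concludes (`IsProjectedRM.rate`). -/

noncomputable section

/-! ### The Poisson law under a shift by one -/

/-- The variance of the Poisson law, in normalized form. -/
lemma hasSum_poisson_mul_sq {l : ℝ} (hl : 0 < l) :
    HasSum (fun n : ℕ => Real.exp (-l) * l ^ n / n.factorial * (n / l - 1) ^ 2) (1 / l) := by
  have h0 : HasSum (fun n : ℕ => Real.exp (-l) * l ^ n / n.factorial) 1 :=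
    hasSum_one_poissonMeasure ⟨l, hl.le⟩
  -- This identity turns each moment into a shifted sum of lower moments; the terms at 0 vanish.
  have hshift : ∀ n : ℕ, Real.exp (-l) * l ^ (n + 1) / (n + 1).factorial * ((n + 1 : ℕ) : ℝ)
      = l * (Real.exp (-l) * l ^ n / n.factorial) := by
    intro n
    rw [Nat.factorial_succ]
    push_cast
    have : (n.factorial : ℝ) ≠ 0 := by positivity
    field_simp
    ring
  have h1 : HasSum (fun n : ℕ => Real.exp (-l) * l ^ n / n.factorial * n) l := by
    rw [← hasSum_nat_add_iff' 1]
    have := h0.mul_left l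
    simp only [Finset.sum_range_one, Nat.cast_zero, mul_zero, sub_zero]
    rw [mul_one] at this
    exact this.congr_fun hshift
  have h2 : HasSum (fun n : ℕ => Real.exp (-l) * l ^ n / n.factorial * n * n) (l * (l + 1)) := by
    rw [← hasSum_nat_add_iff' 1]
    have := (h1.add h0).mul_left l
    simp only [Finset.sum_range_one, Nat.cast_zero, mul_zero, sub_zero]
    refine this.congr_fun fun n => ?_
    rw [hshift]
    push_cast
    ring
  have h3 := ((h2.mul_left (1 / l ^ 2)).sub (h1.mul_left (2 / l))).add h0
  have e : 1 / l ^ 2 * (l * (l + 1)) - 2 / l * l + 1 = 1 / l := by field_simp; ring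
  rw [e] at h3
  refine h3.congr_fun fun n => ?_
  field_simp
  ring

/-- The Poisson law is nearly invariant under the shift by one. -/
lemma tsum_poisson_succ_le {l : ℝ≥0} (hl : 0 < l) (g : ℕ → ℝ≥0∞) (hg : ∀ n, g n ≤ 1) :
    ∑' n, (poissonMeasure l).toPMF n * g (n + 1)
      ≤ ∑' n, (poissonMeasure l).toPMF n * g n + ENNReal.ofReal (2 / √(l : ℝ)) := by
  have hl' : (0 : ℝ) < l := hl
  set s : ℝ := √(l : ℝ)
  have hs : 0 < s := Real.sqrt_pos.mpr hl'
  have hss : s * s = l := Real.mul_self_sqrt hl'.le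
  let p : ℕ → ℝ := fun n => Real.exp (-l) * (l : ℝ) ^ n / n.factorial
  have hp : ∀ n, 0 ≤ p n := fun n => by positivity
  have hpm : ∀ n, (poissonMeasure l).toPMF n = ENNReal.ofReal (p n) := fun n => by
    rw [Measure.toPMF_apply, poissonMeasure_singleton]
  have hvar := hasSum_poisson_mul_sq hl'
  have h0 : HasSum p 1 := hasSum_one_poissonMeasure l
  have hbase : HasSum (fun n => p n * (1 / s) + p n * (n / l - 1) ^ 2 * s) (1 * (1 / s) + 1 / l * s) :=
    (h0.mul_right _).add (hvar.mul_right s)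
  have hval : 1 * (1 / s) + 1 / l * s = 2 / s := by
    rw [← hss]; field_simp; norm_num
  rw [hval] at hbase
  have hsucc : ∀ n, p n = p (n + 1) * (((n + 1 : ℕ) : ℝ) / l) := by
    intro n
    simp only [p]
    rw [Nat.factorial_succ]
    push_cast
    have : (n.factorial : ℝ) ≠ 0 := by positivity
    field_simp
    ring
  -- By `hsucc` the shift reweights the law by n/l. The excess y = n/l - 1 is at most 1/s + s y²
  -- with s = √l; as y² has mean 1/l, both terms contribute 1/s in the mean, which is the bound
  -- 2/√l.
  have hptw : ∀ n : ℕ, p n * (n / l) ≤ p n + (p n * (1 / s) + p n * (n / l - 1) ^ 2 * s) := by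
    intro n
    have : (n : ℝ) / l ≤ 1 + (1 / s + (n / l - 1) ^ 2 * s) := by
      set y : ℝ := n / l - 1
      have hy : (n : ℝ) / l = y + 1 := by ring
      rw [hy]
      have h1 : 1 / s * (1 + (y * s) ^ 2) = 1 / s + y ^ 2 * s := by field_simp
      have h2 : y = 1 / s * (y * s) := by field_simp
      have h3 : 1 / s * (y * s) ≤ 1 / s * (1 + (y * s) ^ 2) := by
        apply mul_le_mul_of_nonneg_left _ (by positivity)
        nlinarith [sq_nonneg (y * s - 1)]
      linarith
    calc p n * (n / l) ≤ p n * (1 + (1 / s + (n / l - 1) ^ 2 * s)) :=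
          mul_le_mul_of_nonneg_left this (hp n)
      _ = _ := by ring
  calc ∑' n, (poissonMeasure l).toPMF n * g (n + 1)
      = ∑' n, ENNReal.ofReal (p (n + 1) * (((n + 1 : ℕ) : ℝ) / l)) * g (n + 1) := by
        simp_rw [hpm, ← hsucc]
    _ ≤ ∑' n, ENNReal.ofReal (p n * (n / l)) * g n := by
        exact ENNReal.tsum_comp_le_tsum_of_injective (f := fun n : ℕ => n + 1)
          (add_left_injective 1) (fun n => ENNReal.ofReal (p n * (n / l)) * g n)
    _ ≤ ∑' n, ((poissonMeasure l).toPMF n * g n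
          + ENNReal.ofReal (p n * (1 / s) + p n * (n / l - 1) ^ 2 * s)) := by
        refine ENNReal.tsum_le_tsum fun n => ?_
        have hq : 0 ≤ p n * (1 / s) + p n * (n / l - 1) ^ 2 * s :=
          add_nonneg (mul_nonneg (hp n) (by positivity))
            (mul_nonneg (mul_nonneg (hp n) (sq_nonneg _)) hs.le)
        calc ENNReal.ofReal (p n * (n / l)) * g n
            ≤ (ENNReal.ofReal (p n)
                + ENNReal.ofReal (p n * (1 / s) + p n * (n / l - 1) ^ 2 * s)) * g n := by
              rw [← ENNReal.ofReal_add (hp n) hq]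
              gcongr
              exact hptw n
          _ ≤ _ := by
              rw [add_mul, hpm]
              gcongr
              exact mul_le_of_le_one_right' (hg n)
    _ = _ := by
        rw [ENNReal.tsum_add, ← ENNReal.ofReal_tsum_of_nonneg _ hbase.summable, hbase.tsum_eq]
        intro n
        exact add_nonneg (mul_nonneg (hp n) (by positivity))
            (mul_nonneg (mul_nonneg (hp n) (sq_nonneg _)) hs.le)

/-! ### Mass that does not escape yields a stationary law -/

/-- A family of laws that is asymptotically invariant under a transition kernel, and does not lose
all its mass at infinity, yields an invariant law. -/
theorem exists_bind_eq_self_of_asymptotically_invariant {S : Type*} [MeasurableSpace S]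
    [DiscreteMeasurableSpace S] (κ : S → PMF S) (q : ℝ → PMF S) (e : ℝ → ℝ≥0∞)
    (he : Tendsto e atTop (𝓝 0)) (hq : ∀ᶠ t in atTop, ∀ ξ, (q t).bind κ ξ ≤ q t ξ + e t)
    (φ : S → ℝ) (hb : ∃ C, ∀ ξ, |φ ξ| ≤ C) (hφ : Tendsto φ cofinite (𝓝 0)) (ε : ℝ) (hε : 0 < ε)
    (hL : ∀ᶠ t in atTop, ε ≤ ∫ ξ, φ ξ ∂(q t).toMeasure) :
    ∃ π : PMF S, π.bind κ = π := by
  classical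
  obtain ⟨C, hC⟩ := hb
  -- By compactness of the product of copies of [0, ∞], an ultrafilter gives limits at all states at
  -- once.
  let U : Ultrafilter ℝ := Ultrafilter.of atTop
  have hU : (U : Filter ℝ) ≤ atTop := Ultrafilter.of_le atTop
  let V : Ultrafilter (S → ℝ≥0∞) := U.map (fun t ξ => q t ξ)
  let a : S → ℝ≥0∞ := V.lim
  have ha : ∀ ξ, Tendsto (fun t => q t ξ) U (𝓝 (a ξ)) := by
    have h : Tendsto (fun t => (fun ξ => q t ξ : S → ℝ≥0∞)) U (𝓝 a) := Ultrafilter.le_nhds_lim V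
    exact fun ξ => (tendsto_pi_nhds.mp h) ξ
  have hsum : ∑' ξ, a ξ ≤ 1 := by
    rw [ENNReal.tsum_eq_iSup_sum]
    refine iSup_le fun F => ?_
    refine le_of_tendsto (tendsto_finsetSum F fun ξ _ => ha ξ) (Eventually.of_forall fun t => ?_)
    rw [← (q t).tsum_coe]
    exact ENNReal.sum_le_tsum F
  -- Only finite partial sums pass to the limit, so a priori the limit is merely subinvariant.
  have hstep : ∀ ξ, ∑' η, a η * κ η ξ ≤ a ξ := by
    intro ξ
    rw [ENNReal.tsum_eq_iSup_sum]
    refine iSup_le fun F => ?_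
    have h1 : Tendsto (fun t => ∑ η ∈ F, q t η * κ η ξ) U (𝓝 (∑ η ∈ F, a η * κ η ξ)) :=
      tendsto_finsetSum F fun η _ =>
        ENNReal.Tendsto.mul_const (ha η) (Or.inr ((κ η).apply_ne_top ξ))
    have h2 : Tendsto (fun t => q t ξ + e t) U (𝓝 (a ξ + 0)) := (ha ξ).add (he.mono_left hU)
    rw [add_zero] at h2
    refine le_of_tendsto_of_tendsto h1 h2 ?_
    filter_upwards [hU hq] with t ht
    refine le_trans ?_ (ht ξ)
    rw [PMF.bind_apply]
    exact ENNReal.sum_le_tsum F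
  -- Outside a finite set F one has φ < ε/2, so ε ≤ ε/2 + (C + 1) q_t(F): the mass of F stays
  -- bounded below. The summand 1 keeps the divisor positive.
  have hne : ∑' ξ, a ξ ≠ 0 := by
    intro h0
    have h0' : ∀ ξ, a ξ = 0 := ENNReal.tsum_eq_zero.mp h0
    have hfin : {ξ | ¬ φ ξ < ε / 2}.Finite :=
      (hφ.eventually (gt_mem_nhds (half_pos hε)))
    let F : Finset S := hfin.toFinset
    have hF : ∀ ξ, ξ ∉ F → φ ξ < ε / 2 := by
      intro ξ h
      by_contra h'
      exact h (hfin.mem_toFinset.mpr h')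
    have hlim : Tendsto (fun t => ∑ ξ ∈ F, q t ξ) U (𝓝 0) := by
      have := tendsto_finsetSum (f := fun ξ t => q t ξ) (x := (U : Filter ℝ)) F fun ξ _ => ha ξ
      simpa [h0'] using this
    have hC0 : 0 ≤ C := by
      by_contra hneg
      obtain ⟨ξ⟩ : Nonempty S := (q 0).support_nonempty.to_subtype.map Subtype.val
      exact hneg ((abs_nonneg _).trans (hC ξ))
    have hlow : ∀ᶠ t in (U : Filter ℝ), ENNReal.ofReal (ε / 2 / (C + 1)) ≤ ∑ ξ ∈ F, q t ξ := by
      filter_upwards [hU hL] with t ht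
      have hint : Integrable φ (q t).toMeasure :=
        Integrable.of_bound (Measurable.of_discrete (f := φ)).aestronglyMeasurable C
          (Eventually.of_forall hC)
      have hm : MeasurableSet (F : Set S) := MeasurableSet.of_discrete
      have hle : ∫ ξ, φ ξ ∂(q t).toMeasure
          ≤ ∫ ξ, (ε / 2 + (F : Set S).indicator (fun _ => C + 1) ξ) ∂(q t).toMeasure := by
        refine integral_mono hint ((integrable_const _).add
          ((integrable_const _).indicator hm)) fun ξ => ?_
        by_cases hξ : ξ ∈ (F : Set S)
        · simp only [Set.indicator_of_mem hξ]
          have := (abs_le.mp (hC ξ)).2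
          linarith
        · simp only [Set.indicator_of_notMem hξ]
          have := hF ξ hξ
          linarith
      rw [integral_add (integrable_const _) ((integrable_const _).indicator hm),
        integral_indicator_const _ hm] at hle
      simp only [integral_const, probReal_univ, smul_eq_mul, one_mul] at hle
      rw [← PMF.toMeasure_apply_finset]
      refine ENNReal.ofReal_le_of_le_toReal ?_
      rw [div_le_iff₀ (by linarith)]
      change _ ≤ (q t).toMeasure.real F * _
      linarith
    have := ge_of_tendsto hlim hlow
    rw [nonpos_iff_eq_zero, ENNReal.ofReal_eq_zero] at this
    exact absurd this (not_le.mpr (by positivity))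
  have hfin : ∑' ξ, a ξ ≠ ∞ := (hsum.trans_lt ENNReal.one_lt_top).ne
  -- The kernel preserves the finite total mass, so a strict inequality at one state is impossible.
  have heq : ∀ ξ, ∑' η, a η * κ η ξ = a ξ := by
    intro ξ
    by_contra h
    have hlt := lt_of_le_of_ne (hstep ξ) h
    have htot : ∑' ξ, ∑' η, a η * κ η ξ = ∑' ξ, a ξ := by
      rw [ENNReal.tsum_comm]
      simp_rw [ENNReal.tsum_mul_left, PMF.tsum_coe, mul_one]
    exact absurd htot (ENNReal.tsum_lt_tsum (htot ▸ hfin) hstep hlt).ne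
  refine ⟨PMF.normalize a hne hfin, ?_⟩
  ext ξ
  simp only [PMF.bind_apply, PMF.normalize_apply]
  conv_rhs => rw [← heq ξ, ← ENNReal.tsum_mul_right]
  refine tsum_congr fun η => ?_
  ring

namespace McQN

variable {s d : ℕ} (N : McQN s d)

instance : DiscreteMeasurableSpace N.State := ⟨fun _ => trivial⟩

instance : Countable N.State := by
  have := N.conf_countable
  unfold State
  infer_instance

lemma iterate_bind_comm {S : Type*} (κ : S → PMF S) (π : PMF S) (n : ℕ) :
    π.bind (fun ξ => (fun μ : PMF S => μ.bind κ)^[n] (PMF.pure ξ))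
      = (fun μ : PMF S => μ.bind κ)^[n] π := by
  induction n with
  | zero => simp
  | succ n ih =>
    simp only [Function.iterate_succ_apply']
    rw [← ih, PMF.bind_bind]

lemma stable_of_bind_step (a : Fin d → ℝ≥0) (π : PMF N.State) (h : π.bind (N.step a) = π) :
    N.Stable a := by
  refine ⟨π, fun t => ?_⟩
  unfold trans
  rw [PMF.bind_comm]
  have : ∀ n, (fun μ : PMF N.State => μ.bind (N.step a))^[n] π = π := fun n => by
    induction n with
    | zero => rfl
    | succ n ih => rw [Function.iterate_succ_apply', ih, h]
  simp_rw [iterate_bind_comm, this, PMF.bind_const]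

lemma unifRate_pos (a : Fin d → ℝ≥0) (k : Fin d) : 0 < N.unifRate a :=
  lt_of_lt_of_le (N.β_pos k)
    ((Finset.single_le_sum (fun _ _ => zero_le) (Finset.mem_univ k)).trans le_add_self)

/-- One extra step replaces the Poisson number n of steps by n + 1, so the shift estimate applies.
-/
lemma trans_bind_step_le (a : Fin d → ℝ≥0) (t : ℝ≥0) (h : 0 < N.unifRate a * t) (ξ η : N.State) :
    (N.trans a t ξ).bind (N.step a) η
      ≤ N.trans a t ξ η + ENNReal.ofReal (2 / √((N.unifRate a * t : ℝ≥0) : ℝ)) := by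
  unfold trans
  rw [PMF.bind_bind, PMF.bind_apply, PMF.bind_apply]
  refine le_trans (le_of_eq (tsum_congr fun n => ?_)) (tsum_poisson_succ_le h
    (fun n => (fun μ : PMF N.State => μ.bind (N.step a))^[n] (PMF.pure ξ) η)
    fun n => PMF.coe_le_one _ _)
  rw [Function.iterate_succ_apply']

/-- If the network is not stable, then `φ(X_t)` does not stay away from zero in the mean. -/
lemma stable_of_meanAt_ge (v : Fin d → ℝ≥0) (hv : v ≠ 0) (φ : N.State → ℝ)
    (hb : ∃ C, ∀ ξ, |φ ξ| ≤ C) (hφ : Tendsto φ cofinite (𝓝 0)) {ε θ : ℝ} (hε : 0 < ε)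
    (h : ∀ᶠ t in atTop, ε ≤ N.meanAt v φ t θ) : N.Stable (ray v θ) := by
  obtain ⟨k, -⟩ : ∃ k, v k ≠ 0 := Function.ne_iff.mp hv
  have hΛ := N.unifRate_pos (ray v θ) k
  have hpos : ∀ t : ℝ, 0 < t → 0 < N.unifRate (ray v θ) * t.toNNReal := fun t ht =>
    mul_pos hΛ (Real.toNNReal_pos.mpr ht)
  have he : Tendsto (fun t : ℝ => ENNReal.ofReal
      (2 / √((N.unifRate (ray v θ) * t.toNNReal : ℝ≥0) : ℝ))) atTop (𝓝 0) := by
    rw [← ENNReal.ofReal_zero]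
    refine (ENNReal.continuous_ofReal.tendsto 0).comp (Tendsto.const_div_atTop ?_ 2)
    refine Real.tendsto_sqrt_atTop.comp ?_
    push_cast
    refine Tendsto.const_mul_atTop (NNReal.coe_pos.mpr hΛ) ?_
    refine tendsto_id.congr' ?_
    filter_upwards [eventually_ge_atTop 0] with t ht
    simp [ht]
  obtain ⟨π, hπ⟩ := exists_bind_eq_self_of_asymptotically_invariant (N.step (ray v θ))
    (fun t : ℝ => N.trans (ray v θ) t.toNNReal N.emptyState) _ he
    (by
      filter_upwards [eventually_gt_atTop 0] with t ht η
      exact N.trans_bind_step_le _ _ (hpos t ht) _ _)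
    φ hb hφ ε hε h
  exact N.stable_of_bind_step _ π hπ

end McQN

/-! ### Overload excludes stability -/

lemma PMF.tsum_bind_mul {α β : Type*} (p : PMF α) (q : α → PMF β) (f : β → ℝ≥0∞) :
    ∑' b, (p.bind q) b * f b = ∑' a, p a * ∑' b, q a b * f b := by
  simp_rw [PMF.bind_apply, ← ENNReal.tsum_mul_right, ← ENNReal.tsum_mul_left]
  rw [ENNReal.tsum_comm]
  simp_rw [mul_assoc]

lemma PMF.tsum_pure_mul {α : Type*} (x : α) (f : α → ℝ≥0∞) : ∑' b, PMF.pure x b * f b = f x := by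
  rw [tsum_eq_single x fun b hb => by rw [PMF.pure_apply_of_ne _ _ hb, zero_mul],
    PMF.pure_apply_self, one_mul]

lemma PMF.tsum_map_mul {α β : Type*} (p : PMF α) (g : α → β) (f : β → ℝ≥0∞) :
    ∑' b, (p.map g) b * f b = ∑' a, p a * f (g a) := by
  rw [← PMF.bind_pure_comp, PMF.tsum_bind_mul]
  simp_rw [Function.comp_apply, PMF.tsum_pure_mul]

namespace McQN

variable {s d : ℕ} (N : McQN s d)

/-- A bounded positive function that contracts under the uniformized chain excludes stability. -/
lemma not_stable_of_contraction (a : Fin d → ℝ≥0) (ha : 0 < N.unifRate a) (f : N.State → ℝ≥0∞)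
    (hf0 : ∀ ξ, f ξ ≠ 0) (hf1 : ∀ ξ, f ξ ≤ 1) (r : ℝ≥0∞) (hr : r < 1)
    (h : ∀ ξ, ∑' η, N.step a ξ η * f η ≤ r * f ξ) : ¬ N.Stable a := by
  rintro ⟨π, hπ⟩
  have hiter : ∀ n, ∑' ξ, ((fun μ : PMF N.State => μ.bind (N.step a))^[n] π) ξ * f ξ
      ≤ r ^ n * ∑' ξ, π ξ * f ξ := by
    intro n
    induction n with
    | zero => simp
    | succ n ih =>
      rw [Function.iterate_succ_apply', PMF.tsum_bind_mul, pow_succ', mul_assoc]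
      refine le_trans ?_ (mul_le_mul_right ih r)
      rw [← ENNReal.tsum_mul_left]
      refine ENNReal.tsum_le_tsum fun ξ => ?_
      rw [mul_left_comm]
      exact mul_le_mul_right (h ξ) _
  set p := (poissonMeasure (N.unifRate a * 1)).toPMF
  have hp : p 1 ≠ 0 := by
    rw [Measure.toPMF_apply, poissonMeasure_singleton]
    simp only [mul_one, pow_one, ne_eq, ENNReal.ofReal_eq_zero, not_le]
    have : (0 : ℝ) < N.unifRate a := ha
    positivity
  -- Exactly one step by time 1 has positive probability, so the averaged contraction factor is
  -- below 1. Invariance at time 1 then contradicts 0 < ∑ π f < ∞.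
  have hR : ∑' n, p n * r ^ n < 1 := by
    have hle : ∀ n, p n * r ^ n ≤ p n := fun n => mul_le_of_le_one_right' (pow_le_one' hr.le n)
    rw [← p.tsum_coe]
    refine ENNReal.tsum_lt_tsum (i := 1) ?_ hle ?_
    · exact ((ENNReal.tsum_le_tsum hle).trans_lt (p.tsum_coe ▸ ENNReal.one_lt_top)).ne
    · rw [pow_one]
      conv_rhs => rw [← mul_one (p 1)]
      exact ENNReal.mul_lt_mul_right hp (p.apply_ne_top 1) hr
  have hone : ∑' ξ, π ξ * f ξ ≤ 1 := by
    rw [← π.tsum_coe]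
    exact ENNReal.tsum_le_tsum fun ξ => mul_le_of_le_one_right' (hf1 ξ)
  have hpos : ∑' ξ, π ξ * f ξ ≠ 0 := by
    rw [Ne, ENNReal.tsum_eq_zero]
    obtain ⟨ξ, hξ⟩ := π.support_nonempty
    exact fun h0 => mul_ne_zero ((π.mem_support_iff ξ).mp hξ) (hf0 ξ) (h0 ξ)
  have hle : ∑' ξ, π ξ * f ξ ≤ (∑' n, p n * r ^ n) * ∑' ξ, π ξ * f ξ := by
    conv_lhs => rw [← hπ 1]
    unfold trans
    rw [PMF.bind_comm]
    simp_rw [iterate_bind_comm]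
    rw [PMF.tsum_bind_mul, ← ENNReal.tsum_mul_right]
    refine ENNReal.tsum_le_tsum fun n => ?_
    rw [mul_assoc]
    exact mul_le_mul_right (hiter n) _
  refine absurd hle (not_le.mpr ?_)
  conv_rhs => rw [← one_mul (∑' ξ, π ξ * f ξ)]
  exact ENNReal.mul_lt_mul_left hpos (hone.trans_lt ENNReal.one_lt_top).ne hR

/-- The inverse `(I - R')⁻¹`. -/
def fundamental : Matrix (Fin d) (Fin d) ℝ := (1 - (N.R.map NNReal.toReal)ᵀ)⁻¹

lemma hasSum_fundamental (i j : Fin d) :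
    HasSum (fun n : ℕ => (((N.R.map NNReal.toReal)ᵀ) ^ n) i j) (N.fundamental i j) :=
  Pi.hasSum.mp (Pi.hasSum.mp N.R_open i) j

lemma pow_routing_nonneg (n : ℕ) (i j : Fin d) : 0 ≤ (((N.R.map NNReal.toReal)ᵀ) ^ n) i j := by
  induction n generalizing i j with
  | zero =>
    rw [pow_zero, Matrix.one_apply]
    split_ifs <;> norm_num
  | succ n ih =>
    rw [pow_succ, Matrix.mul_apply]
    exact Finset.sum_nonneg fun k _ => mul_nonneg (ih i k) (NNReal.coe_nonneg _)

lemma fundamental_nonneg (i j : Fin d) : 0 ≤ N.fundamental i j :=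
  (N.hasSum_fundamental i j).nonneg fun n => N.pow_routing_nonneg n i j

lemma one_le_fundamental (i : Fin d) : 1 ≤ N.fundamental i i := by
  have := le_hasSum (N.hasSum_fundamental i i) 0 fun n _ => N.pow_routing_nonneg n i i
  simpa using this

/-- `R_open` only gives the sum of the Neumann series, while the matrix inverse may be a default
value. Shifting the series by one term shows that it is a genuine inverse. -/
lemma fundamental_mul : N.fundamental * (1 - (N.R.map NNReal.toReal)ᵀ) = 1 := by
  have h1 := N.R_open
  have h2 := h1.mul_right ((N.R.map NNReal.toReal)ᵀ)
  have h3 := (hasSum_nat_add_iff' 1).mpr h1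
  simp only [pow_succ, Finset.sum_range_one, pow_zero] at h3
  have h4 := h2.unique h3
  rw [mul_sub, mul_one]
  change _ - _ * _ = _
  unfold fundamental
  rw [h4]
  abel

/-- The expected remaining work at station `i` caused by a job of class `k`. -/
def workload (i : Fin s) : Fin d → ℝ :=
  (fun k => if N.station k = i then ((N.β k : ℝ))⁻¹ else 0) ᵥ* N.fundamental

lemma workload_nonneg (i : Fin s) (k : Fin d) : 0 ≤ N.workload i k := by
  have h : ∀ j, 0 ≤ (if N.station j = i then ((N.β j : ℝ))⁻¹ else 0) := fun j => by
    split_ifs <;> positivity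
  simp only [workload, Matrix.vecMul, dotProduct]
  exact Finset.sum_nonneg fun j _ => mul_nonneg (h j) (N.fundamental_nonneg j k)

/-- First-step equation: a job of class k brings its own mean service time if it is served at i, and
then the workload of the class it turns into. -/
lemma workload_sub (i : Fin s) (k : Fin d) :
    N.workload i k - ∑ l, (N.R k l : ℝ) * N.workload i l
      = if N.station k = i then ((N.β k : ℝ))⁻¹ else 0 := by
  have h : N.workload i ᵥ* (1 - (N.R.map NNReal.toReal)ᵀ)
      = fun k => if N.station k = i then ((N.β k : ℝ))⁻¹ else 0 := by
    unfold workload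
    rw [Matrix.vecMul_vecMul, fundamental_mul, Matrix.vecMul_one]
  have h' := congrFun h k
  rw [Matrix.vecMul_sub, Matrix.vecMul_one] at h'
  rw [← h', Pi.sub_apply]
  congr 1
  refine Finset.sum_congr rfl fun l _ => ?_
  rw [mul_comm]
  rfl

lemma workload_dotProduct (i : Fin s) (v : Fin d → ℝ≥0) :
    ∑ k, (v k : ℝ) * N.workload i k = N.traffic v i := by
  have h : N.workload i ⬝ᵥ (fun k => (v k : ℝ)) = N.traffic v i := by
    unfold workload traffic effRate
    rw [← Matrix.dotProduct_mulVec, dotProduct, Finset.sum_filter]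
    refine Finset.sum_congr rfl fun k _ => ?_
    change _ * (N.fundamental *ᵥ _) k = if _ then (N.fundamental *ᵥ _) k / _ else _
    split_ifs
    · rw [div_eq_mul_inv, mul_comm]
    · rw [zero_mul]
  rw [← h, dotProduct]
  exact Finset.sum_congr rfl fun k _ => mul_comm _ _

/-- The number of jobs of class `k` in the network. -/
def classCount (ξ : N.State) (k : Fin d) : ℕ := N.count (N.station k) (ξ (N.station k)) k

lemma insertJob_self (l : Fin d) (ξ : N.State) : N.insertJob l ξ (N.station l)
    = N.insert (N.station l) l (ξ (N.station l)) :=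
  Function.update_self (β := N.Conf) _ _ _

lemma insertJob_of_ne (l : Fin d) (ξ : N.State) {i : Fin s} (h : i ≠ N.station l) :
    N.insertJob l ξ i = ξ i :=
  Function.update_of_ne (β := N.Conf) h _ _

lemma deleteJob_self (l : Fin d) (ξ : N.State) : N.deleteJob l ξ (N.station l)
    = N.delete (N.station l) l (ξ (N.station l)) :=
  Function.update_self (β := N.Conf) _ _ _

lemma deleteJob_of_ne (l : Fin d) (ξ : N.State) {i : Fin s} (h : i ≠ N.station l) :
    N.deleteJob l ξ i = ξ i :=
  Function.update_of_ne (β := N.Conf) h _ _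

lemma classCount_insertJob (l : Fin d) (ξ : N.State) :
    N.classCount (N.insertJob l ξ) = N.classCount ξ + Pi.single l 1 := by
  funext k
  simp only [classCount, Pi.add_apply]
  by_cases h : N.station k = N.station l
  · rw [h, insertJob_self, N.count_insert _ _ _ rfl, Pi.add_apply]
  · rw [N.insertJob_of_ne _ _ h]
    have : k ≠ l := fun e => h (e ▸ rfl)
    simp [this]

lemma classCount_deleteJob (l : Fin d) (ξ : N.State)
    (hW : 0 < N.W (N.station l) (ξ (N.station l)) l) :
    N.classCount (N.deleteJob l ξ) + Pi.single l 1 = N.classCount ξ := by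
  funext k
  simp only [classCount, Pi.add_apply]
  by_cases h : N.station k = N.station l
  · rw [h, deleteJob_self]
    exact congrFun (N.count_delete _ _ _ rfl hW) k
  · rw [N.deleteJob_of_ne _ _ h]
    have : k ≠ l := fun e => h (e ▸ rfl)
    simp [this]

/-- The expected total work for station `i` in the network. -/
def totalWork (i : Fin s) (ξ : N.State) : ℝ := ∑ k, (N.classCount ξ k : ℝ) * N.workload i k

lemma totalWork_nonneg (i : Fin s) (ξ : N.State) : 0 ≤ N.totalWork i ξ :=
  Finset.sum_nonneg fun k _ => mul_nonneg (Nat.cast_nonneg _) (N.workload_nonneg i k)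

lemma totalWork_of_classCount (i : Fin s) {ξ ξ' : N.State} {l : Fin d}
    (h : N.classCount ξ' = N.classCount ξ + Pi.single l 1) :
    N.totalWork i ξ' = N.totalWork i ξ + N.workload i l := by
  have hs : ∑ k, ((Pi.single l 1 : Fin d → ℕ) k : ℝ) * N.workload i k = N.workload i l := by
    rw [Finset.sum_eq_single l]
    · simp
    · intro k _ hk
      simp [hk]
    · simp
  unfold totalWork
  rw [← hs, ← Finset.sum_add_distrib]
  refine Finset.sum_congr rfl fun k _ => ?_
  rw [h, Pi.add_apply, Nat.cast_add, add_mul]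

/-- The change of the total work for station `i` by a transition. -/
def workJump (i : Fin s) : Option (Fin d) × Option (Fin d) → ℝ
  | (k, l) => l.elim 0 (N.workload i) - k.elim 0 (N.workload i)

/-- A nonzero rate is needed: a deletion has the expected effect on the counts only if the class is
in service. -/
lemma totalWork_target (a : Fin d → ℝ≥0) (i : Fin s) (ξ : N.State)
    (τ : Option (Fin d) × Option (Fin d)) (hτ : N.rate a ξ τ ≠ 0) :
    N.totalWork i (N.target ξ τ) = N.totalWork i ξ + N.workJump i τ := by
  have hins : ∀ l ξ, N.totalWork i (N.insertJob l ξ) = N.totalWork i ξ + N.workload i l :=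
    fun l ξ => N.totalWork_of_classCount i (N.classCount_insertJob l ξ)
  have hdel : ∀ k l, N.rate a ξ (some k, l) ≠ 0 →
      N.totalWork i (N.deleteJob k ξ) = N.totalWork i ξ - N.workload i k := by
    intro k l hk
    have hW : 0 < N.W (N.station k) (ξ (N.station k)) k := by
      refine pos_iff_ne_zero.mpr fun h0 => hk ?_
      simp [rate, h0]
    rw [N.totalWork_of_classCount i (N.classCount_deleteJob k ξ hW).symm]
    ring
  rcases τ with ⟨_ | k, _ | l⟩
  · exact absurd rfl hτ
  · simp [target, workJump, hins]
  · simp [target, workJump, hdel k _ hτ]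
    ring
  · simp [target, workJump, hins, hdel k _ hτ]
    ring

/-- Arrivals add work at the traffic rate. In services, β_k cancels against the mean service time,
so work is removed at the rate ∑ W over the classes of station i, which is at most 1. -/
lemma sum_rate_mul_workJump (a : Fin d → ℝ≥0) (i : Fin s) (ξ : N.State) :
    N.traffic a i - 1 ≤ ∑ τ, (N.rate a ξ τ : ℝ) * N.workJump i τ := by
  have hk : ∀ k, ∑ l, (N.rate a ξ (some k, l) : ℝ) * N.workJump i (some k, l)
      = - if N.station k = i then (N.W i (ξ i) k : ℝ) else 0 := by
    intro k
    have hroute : ∑ l, (N.route k l : ℝ) = 1 := by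
      rw [← NNReal.coe_sum, N.route_sum, NNReal.coe_one]
    have h1 : ∑ l, (N.route k l : ℝ) * N.workJump i (some k, l)
        = - if N.station k = i then ((N.β k : ℝ))⁻¹ else 0 := by
      rw [← N.workload_sub i k]
      simp only [workJump, Option.elim_some, mul_sub]
      rw [Finset.sum_sub_distrib, ← Finset.sum_mul, hroute, Fintype.sum_option]
      simp [route]
    simp only [rate, NNReal.coe_mul]
    simp_rw [mul_assoc, ← Finset.mul_sum, h1]
    have hβ : (N.β k : ℝ) ≠ 0 := (NNReal.coe_pos.mpr (N.β_pos k)).ne'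
    split_ifs with h
    · subst h
      field_simp
    · simp
  have hsum : ∑ k, (if N.station k = i then (N.W i (ξ i) k : ℝ) else 0) ≤ 1 := by
    refine le_trans (Finset.sum_le_sum (g := fun k => (N.W i (ξ i) k : ℝ)) fun k _ => ?_) ?_
    · split_ifs <;> simp
    · rw [← NNReal.coe_sum, ← NNReal.coe_one, NNReal.coe_le_coe]
      -- `W_sum` is silent about the empty queue, where all fractions vanish because no class is
      -- present.
      by_cases hp : ξ i = N.empty i
      · have h0 : ∀ k, N.W i (ξ i) k = 0 := by
          intro k
          by_contra h
          have h1 := N.count_pos_of_W_pos i _ k (pos_iff_ne_zero.mpr h)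
          rw [(N.count_eq_zero_iff i _).mpr hp] at h1
          exact lt_irrefl _ h1
        simp [h0]
      · exact (N.W_sum i _ hp).le
  rw [Fintype.sum_prod_type, Fintype.sum_option]
  simp_rw [hk]
  rw [Finset.sum_neg_distrib, Fintype.sum_option]
  simp only [rate, workJump, Option.elim_none, Option.elim_some, sub_zero, NNReal.coe_zero,
    zero_mul, zero_add]
  rw [N.workload_dotProduct i a]
  linarith

lemma tsum_step_mul_ofReal (a : Fin d → ℝ≥0) (ξ : N.State) (g : N.State → ℝ) (hg : ∀ ξ, 0 ≤ g ξ) :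
    ∑' η, N.step a ξ η * ENNReal.ofReal (g η)
      = ENNReal.ofReal ((1 - (∑ τ, (N.rate a ξ τ : ℝ)) / N.unifRate a) * g ξ
        + ∑ τ, (N.rate a ξ τ : ℝ) / N.unifRate a * g (N.target ξ τ)) := by
  have hle : (∑ τ, N.rate a ξ τ) / N.unifRate a ≤ 1 :=
    div_le_one_of_le₀ (N.rate_sum_le a ξ) zero_le
  have hle' : (∑ τ, (N.rate a ξ τ : ℝ)) / N.unifRate a ≤ 1 := by exact_mod_cast hle
  unfold step
  rw [PMF.tsum_map_mul, tsum_fintype, Fintype.sum_option]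
  rw [ENNReal.ofReal_add (mul_nonneg (by linarith) (hg _))
    (Finset.sum_nonneg fun τ _ => mul_nonneg (by positivity) (hg _)),
    ENNReal.ofReal_sum_of_nonneg fun τ _ => mul_nonneg (by positivity) (hg _),
    ENNReal.ofReal_mul (by linarith)]
  congr 1
  · simp only [stepChoice, PMF.ofFintype_apply, Option.elim_none]
    congr 1
    rw [← ENNReal.ofReal_coe_nnreal, NNReal.coe_sub hle]
    push_cast
    rfl
  · refine Finset.sum_congr rfl fun τ _ => ?_
    rw [ENNReal.ofReal_mul (by positivity)]
    simp only [stepChoice, PMF.ofFintype_apply, Option.elim_some]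
    rw [← ENNReal.ofReal_coe_nnreal]
    push_cast
    rfl

/-- In a stable network, no station is overloaded. -/
theorem traffic_le_one_of_stable (a : Fin d → ℝ≥0) (h : N.Stable a) (i : Fin s) :
    N.traffic a i ≤ 1 := by
  by_contra! hlt
  obtain ⟨k₀, -⟩ := N.station_surj i
  have hΛ := N.unifRate_pos a k₀
  have hΛ' : (0 : ℝ) < N.unifRate a := hΛ
  set Λ : ℝ := (N.unifRate a : ℝ)
  set δ : ℝ := N.traffic a i - 1
  have hδ : 0 < δ := sub_pos.mpr hlt
  set K : ℝ := ∑ τ, |N.workJump i τ| + 1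
  have hK1 : 1 ≤ K := le_add_of_nonneg_left (Finset.sum_nonneg fun _ _ => abs_nonneg _)
  have hK : ∀ τ, |N.workJump i τ| ≤ K := fun τ =>
    (Finset.single_le_sum (f := fun τ => |N.workJump i τ|) (fun _ _ => abs_nonneg _)
      (Finset.mem_univ τ)).trans (le_add_of_nonneg_right zero_le_one)
  have hK0 : 0 < K := by linarith
  -- The bound α K ≤ 1 is the range of |e^x - 1 - x| ≤ x². The second condition lets the quadratic
  -- error use at most half of the linear gain α δ; the other half, divided by Λ, is γ.
  obtain ⟨α, hα0, hα1, hα2⟩ : ∃ α : ℝ, 0 < α ∧ α * K ≤ 1 ∧ α * (K ^ 2 * Λ) ≤ δ / 2 := by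
    refine ⟨min (1 / K) (δ / 2 / (K ^ 2 * Λ)), by positivity, ?_, ?_⟩
    · rw [← le_div_iff₀ hK0]
      exact min_le_left _ _
    · rw [← le_div_iff₀ (by positivity)]
      exact min_le_right _ _
  set γ : ℝ := α * (δ / 2) / Λ
  have hγ : 0 < γ := by positivity
  refine N.not_stable_of_contraction a hΛ
    (fun ξ => ENNReal.ofReal (Real.exp (-(α * N.totalWork i ξ)))) (fun ξ => ?_) (fun ξ => ?_)
    (ENNReal.ofReal (1 - γ)) ?_ (fun ξ => ?_) h
  · exact (ENNReal.ofReal_pos.mpr (Real.exp_pos _)).ne'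
  · rw [ENNReal.ofReal_le_one, Real.exp_le_one_iff, neg_nonpos]
    exact mul_nonneg hα0.le (N.totalWork_nonneg i ξ)
  · rw [ENNReal.ofReal_lt_one]
    linarith
  · rw [N.tsum_step_mul_ofReal a ξ _ fun _ => (Real.exp_pos _).le,
      ← ENNReal.ofReal_mul' (Real.exp_pos _).le]
    refine ENNReal.ofReal_le_ofReal ?_
    set E := Real.exp (-(α * N.totalWork i ξ))
    have hE : 0 < E := Real.exp_pos _
    have hterm : ∀ τ, (N.rate a ξ τ : ℝ) / Λ * Real.exp (-(α * N.totalWork i (N.target ξ τ)))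
        ≤ (N.rate a ξ τ : ℝ) / Λ * E
          + E / Λ * (-α * ((N.rate a ξ τ : ℝ) * N.workJump i τ)
            + α * (α * K ^ 2) * N.rate a ξ τ) := by
      intro τ
      by_cases hτ : N.rate a ξ τ = 0
      · simp [hτ]
      rw [N.totalWork_target a i ξ τ hτ]
      have e1 : Real.exp (-(α * (N.totalWork i ξ + N.workJump i τ)))
          = E * Real.exp (-(α * N.workJump i τ)) := by
        rw [← Real.exp_add]
        ring_nf
      have habs : |-(α * N.workJump i τ)| ≤ α * K := by
        rw [abs_neg, abs_mul, abs_of_pos hα0]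
        exact mul_le_mul_of_nonneg_left (hK τ) hα0.le
      have h1 := (abs_le.mp (Real.abs_exp_sub_one_sub_id_le (habs.trans hα1))).2
      have h2 : (-(α * N.workJump i τ)) ^ 2 ≤ (α * K) ^ 2 := sq_le_sq' (abs_le.mp habs).1
        (abs_le.mp habs).2
      have h3 : Real.exp (-(α * N.workJump i τ))
          ≤ 1 - α * N.workJump i τ + α * (α * K ^ 2) := by
        have : (α * K) ^ 2 = α * (α * K ^ 2) := by ring
        linarith
      rw [e1]
      calc (N.rate a ξ τ : ℝ) / Λ * (E * Real.exp (-(α * N.workJump i τ)))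
          ≤ (N.rate a ξ τ : ℝ) / Λ * (E * (1 - α * N.workJump i τ + α * (α * K ^ 2))) := by
            gcongr
        _ = _ := by ring
    have hsumle : ∑ τ, (N.rate a ξ τ : ℝ) ≤ Λ := by
      exact_mod_cast N.rate_sum_le a ξ
    have hdrift := N.sum_rate_mul_workJump a i ξ
    have hb : -α * (∑ τ, (N.rate a ξ τ : ℝ) * N.workJump i τ)
        + α * (α * K ^ 2) * ∑ τ, (N.rate a ξ τ : ℝ) ≤ -(α * (δ / 2)) := by
      have h1 : α * δ ≤ α * ∑ τ, (N.rate a ξ τ : ℝ) * N.workJump i τ :=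
        mul_le_mul_of_nonneg_left hdrift hα0.le
      have h2 : α * (α * K ^ 2) * ∑ τ, (N.rate a ξ τ : ℝ) ≤ α * (δ / 2) := by
        calc α * (α * K ^ 2) * ∑ τ, (N.rate a ξ τ : ℝ) ≤ α * (α * K ^ 2) * Λ := by gcongr
          _ = α * (α * (K ^ 2 * Λ)) := by ring
          _ ≤ _ := mul_le_mul_of_nonneg_left hα2 hα0.le
      linarith
    calc (1 - (∑ τ, (N.rate a ξ τ : ℝ)) / Λ) * E
          + ∑ τ, (N.rate a ξ τ : ℝ) / Λ * Real.exp (-(α * N.totalWork i (N.target ξ τ)))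
        ≤ (1 - (∑ τ, (N.rate a ξ τ : ℝ)) / Λ) * E
          + ∑ τ, ((N.rate a ξ τ : ℝ) / Λ * E
          + E / Λ * (-α * ((N.rate a ξ τ : ℝ) * N.workJump i τ)
            + α * (α * K ^ 2) * N.rate a ξ τ)) := by
          gcongr with τ _
          exact hterm τ
      _ = E + E / Λ * (-α * (∑ τ, (N.rate a ξ τ : ℝ) * N.workJump i τ)
            + α * (α * K ^ 2) * ∑ τ, (N.rate a ξ τ : ℝ)) := by
          rw [Finset.sum_add_distrib, ← Finset.sum_mul, ← Finset.sum_div, ← Finset.mul_sum,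
            Finset.sum_add_distrib, ← Finset.mul_sum, ← Finset.mul_sum]
          ring
      _ ≤ E + E / Λ * (-(α * (δ / 2))) := by gcongr
      _ = (1 - γ) * E := by
          simp only [γ]
          ring

lemma traffic_ray (v : Fin d → ℝ≥0) {θ : ℝ} (hθ : 0 ≤ θ) (i : Fin s) :
    N.traffic (ray v θ) i = θ * N.traffic v i := by
  rw [← workload_dotProduct, ← workload_dotProduct, Finset.mul_sum]
  refine Finset.sum_congr rfl fun k _ => ?_
  simp only [ray, NNReal.coe_mul, Real.coe_toNNReal θ hθ]
  ring

lemma effRate_nonneg (v : Fin d → ℝ≥0) (k : Fin d) : 0 ≤ N.effRate v k := by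
  change 0 ≤ ∑ j, N.fundamental k j * (v j : ℝ)
  exact Finset.sum_nonneg fun j _ => mul_nonneg (N.fundamental_nonneg k j) (NNReal.coe_nonneg _)

lemma le_effRate (v : Fin d → ℝ≥0) (k : Fin d) : (v k : ℝ) ≤ N.effRate v k := by
  calc (v k : ℝ) ≤ N.fundamental k k * v k :=
        le_mul_of_one_le_left (NNReal.coe_nonneg _) (N.one_le_fundamental k)
    _ ≤ N.effRate v k := Finset.single_le_sum (f := fun j => N.fundamental k j * (v j : ℝ))
        (fun j _ => mul_nonneg (N.fundamental_nonneg k j) (NNReal.coe_nonneg _))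
        (Finset.mem_univ k)

/-- A class with external input has effective rate at least this input, because the diagonal of the
Neumann series is at least 1. Thus the inverse in `subcrit` is not a default value. -/
lemma iSup_traffic_pos (v : Fin d → ℝ≥0) (hv : v ≠ 0) : 0 < ⨆ i, N.traffic v i := by
  obtain ⟨k, hk⟩ : ∃ k, v k ≠ 0 := Function.ne_iff.mp hv
  refine lt_of_lt_of_le ?_ (le_ciSup (Set.finite_range _).bddAbove (N.station k))
  have hβ : ∀ j, (0 : ℝ) < N.β j := N.β_pos
  have hvk : (0 : ℝ) < v k := NNReal.coe_pos.mpr (pos_iff_ne_zero.mpr hk)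
  calc (0 : ℝ) < N.effRate v k / N.β k := div_pos (hvk.trans_le (N.le_effRate v k)) (hβ k)
    _ ≤ N.traffic v (N.station k) := by
      refine Finset.single_le_sum (f := fun j => N.effRate v j / N.β j)
        (fun j _ => div_nonneg (N.effRate_nonneg v j) (hβ j).le) ?_
      simp

lemma subcrit_pos (v : Fin d → ℝ≥0) (hv : v ≠ 0) : 0 < N.subcrit v :=
  inv_pos.mpr (N.iSup_traffic_pos v hv)

/-- The stability set is bounded by the sub-critical threshold. -/
lemma le_subcrit_of_mem_stableSet (v : Fin d → ℝ≥0) (hv : v ≠ 0) {θ : ℝ}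
    (hθ : θ ∈ N.stableSet v) : θ ≤ N.subcrit v := by
  obtain ⟨k, -⟩ : ∃ k, v k ≠ 0 := Function.ne_iff.mp hv
  have : Nonempty (Fin s) := ⟨N.station k⟩
  obtain ⟨i, hi⟩ := exists_eq_ciSup_of_finite (f := N.traffic v)
  have hpos := N.iSup_traffic_pos v hv
  have h := N.traffic_le_one_of_stable _ hθ.2 i
  rw [N.traffic_ray v hθ.1, hi] at h
  unfold subcrit
  rwa [← one_div, le_div_iff₀ hpos]

end McQN

/-! ### From conditional laws to conditional means -/

/-- A bounded random variable with a given regular conditional law has the mean of this law as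
conditional expectation. -/
theorem condExp_eq_integral_of_condLaw {Ω : Type*} {m mΩ : MeasurableSpace Ω} (hm : m ≤ mΩ)
    {P : Measure Ω} [IsProbabilityMeasure P] {Z : Ω → ℝ} (hZ : Measurable Z) (ν : Ω → Measure ℝ)
    [∀ ω, IsProbabilityMeasure (ν ω)] (C : ℝ) (hν : ∀ ω, ∀ᵐ y ∂(ν ω), |y| ≤ C)
    (h : ∀ A : Set ℝ, MeasurableSet A →
      P[(Z ⁻¹' A).indicator (fun _ => (1 : ℝ)) | m] =ᵐ[P] fun ω => (ν ω).real A) :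
    (∀ᵐ ω ∂P, |Z ω| ≤ C) ∧ P[Z | m] =ᵐ[P] fun ω => ∫ y, y ∂(ν ω) := by
  have hint1 : ∀ A : Set ℝ, MeasurableSet A →
      Integrable ((Z ⁻¹' A).indicator (fun _ => (1 : ℝ))) P := fun A hA =>
    (integrable_const _).indicator (hZ hA)
  have hbd : ∀ᵐ ω ∂P, |Z ω| ≤ C := by
    have hA : MeasurableSet {y : ℝ | |y| ≤ C}ᶜ :=
      (measurableSet_le measurable_id.abs measurable_const).compl
    have h1 := integral_condExp (μ := P) (f := (Z ⁻¹' {y : ℝ | |y| ≤ C}ᶜ).indicator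
      (fun _ => (1 : ℝ))) hm
    rw [integral_congr_ae (h _ hA), integral_indicator_const _ (hZ hA)] at h1
    have h2 : ∀ ω, (ν ω).real {y : ℝ | |y| ≤ C}ᶜ = 0 := fun ω => by
      rw [measureReal_eq_zero_iff]
      exact hν ω
    simp only [h2, integral_zero, smul_eq_mul, mul_one] at h1
    exact (measureReal_eq_zero_iff).mp h1.symm
  refine ⟨hbd, ?_⟩
  have hZint : Integrable Z P := Integrable.of_bound hZ.aestronglyMeasurable C hbd
  -- The hypothesis concerns indicators. Rounding y down to a multiple of 1/(N + 1) gives a finite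
  -- combination of them on [-C, C], at a cost of 1/(N + 1) on each side.
  have key : ∀ N : ℕ, ∀ᵐ ω ∂P, |(P[Z | m]) ω - ∫ y, y ∂(ν ω)| ≤ 2 * (1 / ((N : ℝ) + 1)) := by
    intro N
    have hN : (0 : ℝ) < (N : ℝ) + 1 := by positivity
    let A : ℤ → Set ℝ := fun j => {y | ⌊((N : ℝ) + 1) * y⌋ = j}
    have hA : ∀ j, MeasurableSet (A j) := fun j =>
      (Int.measurable_floor.comp (measurable_const.mul measurable_id)) (measurableSet_singleton j)
    let J : Finset ℤ := Finset.Icc ⌊((N : ℝ) + 1) * (-C)⌋ ⌊((N : ℝ) + 1) * C⌋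
    let f : ℝ → ℝ := fun y => ∑ j ∈ J, (A j).indicator (fun _ => (j : ℝ) / ((N : ℝ) + 1)) y
    have hfm : Measurable f := Finset.measurable_sum _ fun j _ => measurable_const.indicator (hA j)
    have hf : ∀ y, |y| ≤ C → |f y - y| ≤ 1 / ((N : ℝ) + 1) := by
      intro y hy
      have hmem : ⌊((N : ℝ) + 1) * y⌋ ∈ J := by
        rw [Finset.mem_Icc]
        constructor <;> apply Int.floor_mono <;> apply mul_le_mul_of_nonneg_left _ hN.le
        exacts [(abs_le.mp hy).1, (abs_le.mp hy).2]
      have hval : f y = (⌊((N : ℝ) + 1) * y⌋ : ℝ) / ((N : ℝ) + 1) := by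
        simp only [f]
        rw [Finset.sum_eq_single_of_mem _ hmem]
        · rw [Set.indicator_of_mem]
          rfl
        · intro j _ hj
          rw [Set.indicator_of_notMem]
          exact fun h' => hj h'.symm
      have h1 := Int.floor_le (((N : ℝ) + 1) * y)
      have h2 := Int.lt_floor_add_one (((N : ℝ) + 1) * y)
      rw [hval, div_sub' hN.ne', abs_div, abs_of_pos hN]
      gcongr
      rw [abs_le]
      constructor <;> linarith
    have hfZ : (fun ω => f (Z ω)) = ∑ j ∈ J, ((j : ℝ) / ((N : ℝ) + 1)) •
        (Z ⁻¹' (A j)).indicator (fun _ => (1 : ℝ)) := by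
      funext ω
      simp only [f, Finset.sum_apply, Pi.smul_apply, smul_eq_mul]
      refine Finset.sum_congr rfl fun j _ => ?_
      by_cases hω : Z ω ∈ A j
      · rw [Set.indicator_of_mem hω, Set.indicator_of_mem (by exact hω), mul_one]
      · rw [Set.indicator_of_notMem hω, Set.indicator_of_notMem (by exact hω), mul_zero]
    have hsmul : ∀ j ∈ J, Integrable (((j : ℝ) / ((N : ℝ) + 1)) •
        (Z ⁻¹' (A j)).indicator (fun _ => (1 : ℝ))) P := fun j _ => (hint1 _ (hA j)).smul _
    have hfint : Integrable (fun ω => f (Z ω)) P := by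
      rw [hfZ]
      exact integrable_finsetSum' J hsmul
    have hcond : P[fun ω => f (Z ω) | m] =ᵐ[P] fun ω => ∫ y, f y ∂(ν ω) := by
      rw [hfZ]
      refine (condExp_finsetSum hsmul m).trans ?_
      have h1 : ∀ᵐ ω ∂P, ∀ j : ℤ, (P[((j : ℝ) / ((N : ℝ) + 1)) •
          (Z ⁻¹' (A j)).indicator (fun _ => (1 : ℝ)) | m]) ω
          = (j : ℝ) / ((N : ℝ) + 1) * (ν ω).real (A j) := by
        rw [ae_all_iff]
        intro j
        filter_upwards [condExp_smul ((j : ℝ) / ((N : ℝ) + 1))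
          ((Z ⁻¹' (A j)).indicator (fun _ => (1 : ℝ))) m (μ := P), h _ (hA j)] with ω h2 h3
        rw [h2, Pi.smul_apply, h3, smul_eq_mul]
      filter_upwards [h1] with ω hω
      rw [Finset.sum_apply, integral_finsetSum _ fun j _ => (integrable_const _).indicator (hA j)]
      refine Finset.sum_congr rfl fun j _ => ?_
      rw [hω j, integral_indicator_const _ (hA j), smul_eq_mul, mul_comm]
    have hd1 : ∀ᵐ ω ∂P, |(P[Z - fun ω => f (Z ω) | m]) ω| ≤ 1 / ((N : ℝ) + 1) := by
      refine ae_bdd_abs_condExp_of_ae_bdd_abs (R := 1 / ((N : ℝ) + 1)) ?_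
      filter_upwards [hbd] with ω hω
      rw [Pi.sub_apply, abs_sub_comm]
      exact hf _ hω
    filter_upwards [hd1, hcond, condExp_sub hZint hfint m] with ω h1 h2 h3
    rw [h3, Pi.sub_apply, h2] at h1
    have hidint : Integrable (fun y : ℝ => y) (ν ω) :=
      Integrable.of_bound measurable_id.aestronglyMeasurable C (hν ω)
    have hfint' : Integrable f (ν ω) :=
      integrable_finsetSum _ fun j _ => (integrable_const _).indicator (hA j)
    have h4 : |∫ y, f y ∂(ν ω) - ∫ y, y ∂(ν ω)| ≤ 1 / ((N : ℝ) + 1) := by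
      rw [← integral_sub hfint' hidint]
      have := norm_integral_le_of_norm_le_const (μ := ν ω) (f := fun y => f y - y)
        (C := 1 / ((N : ℝ) + 1)) (by
          filter_upwards [hν ω] with y hy
          exact hf y hy)
      simpa using this
    calc |(P[Z | m]) ω - ∫ y, y ∂(ν ω)|
        ≤ |(P[Z | m]) ω - ∫ y, f y ∂(ν ω)| + |∫ y, f y ∂(ν ω) - ∫ y, y ∂(ν ω)| :=
          abs_sub_le _ _ _
      _ ≤ _ := by linarith
  filter_upwards [ae_all_iff.mpr key] with ω hω
  have hlim : Tendsto (fun N : ℕ => 2 * (1 / ((N : ℝ) + 1))) atTop (𝓝 (2 * 0)) :=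
    tendsto_one_div_add_atTop_nhds_zero_nat.const_mul 2
  rw [mul_zero] at hlim
  have h0 := ge_of_tendsto' hlim hω
  exact sub_eq_zero.mp (abs_eq_zero.mp (le_antisymm h0 (abs_nonneg _)))

/-! ### Projected Robbins–Monro iterates: almost sure convergence -/

/-- The signed distance of `x` from the interval `[a, b]`. -/
def excess (a b x : ℝ) : ℝ := max (x - b) 0 - max (a - x) 0

lemma continuous_excess (a b : ℝ) : Continuous (excess a b) := by
  unfold excess
  fun_prop

lemma excess_self (a x : ℝ) : excess a a x = x - a := by
  unfold excess
  rcases le_total x a with h | h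
  · rw [max_eq_right (by linarith), max_eq_left (by linarith)]; ring
  · rw [max_eq_left (by linarith), max_eq_right (by linarith)]; ring

lemma sub_excess_mem {a b : ℝ} (hab : a ≤ b) (x : ℝ) : x - excess a b x ∈ Set.Icc a b := by
  unfold excess
  constructor <;> rcases max_cases (x - b) 0 with ⟨h1, _⟩ | ⟨h1, _⟩ <;>
    rcases max_cases (a - x) 0 with ⟨h2, _⟩ | ⟨h2, _⟩ <;> rw [h1, h2] <;> linarith

lemma abs_excess_le {a b : ℝ} (p x : ℝ) (hp : p ∈ Set.Icc a b) :
    |excess a b x| ≤ |x - p| := by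
  obtain ⟨h3, h4⟩ := hp
  unfold excess
  rcases max_cases (x - b) 0 with ⟨h1, _⟩ | ⟨h1, _⟩ <;>
    rcases max_cases (a - x) 0 with ⟨h2, _⟩ | ⟨h2, _⟩ <;> rw [h1, h2] <;>
    first
    | (simp only [sub_zero]; rw [abs_of_nonneg (by linarith), abs_of_nonneg (by linarith)]; linarith)
    | (simp only [zero_sub]; rw [abs_neg, abs_of_nonneg (by linarith),
        abs_of_nonpos (by linarith)]; linarith)
    | simp
    | (rw [abs_le]; constructor <;> linarith [abs_nonneg (x - p)])

/-- The point of [a, b] nearest to x, used as a competitor for x + y, gives the bound (excess + y)².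
-/
lemma excess_add_sq_le {a b : ℝ} (hab : a ≤ b) (x y : ℝ) :
    excess a b (x + y) ^ 2 ≤ excess a b x ^ 2 + 2 * excess a b x * y + y ^ 2 := by
  have h := sq_le_sq.mpr (abs_excess_le _ (x + y) (sub_excess_mem hab x))
  calc _ ≤ _ := h
    _ = _ := by ring

/-- Only the left end needs to lie in [0, r]; b may exceed r. This matters because θ + δ may lie
beyond the projection bound. -/
lemma excess_proj_sq_le {a b r : ℝ} (hab : a ≤ b) (ha : a ∈ Set.Icc 0 r) (y : ℝ) :
    excess a b (min r (max y 0)) ^ 2 ≤ excess a b y ^ 2 := by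
  obtain ⟨h0, h1⟩ := ha
  rcases le_total y 0 with hy | hy
  · rw [max_eq_right hy, min_eq_right (h0.trans h1)]
    unfold excess
    rw [max_eq_right (by linarith), max_eq_left (by linarith), max_eq_right (by linarith),
      max_eq_left (by linarith)]
    nlinarith
  · rw [max_eq_left hy]
    rcases le_total y r with hr | hr
    · rw [min_eq_right hr]
    · rw [min_eq_left hr]
      unfold excess
      rw [max_eq_right (a := a - r) (by linarith), max_eq_right (a := a - y) (by linarith)]
      simp only [sub_zero]
      have := le_max_right (r - b) 0
      gcongr

/-- Robbins–Monro iterates, projected to `[0, r]`, with observations whose conditional means given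
the past are `h n (X n)`. -/
structure IsProjectedRM {Ω : Type*} {mΩ : MeasurableSpace Ω} (P : Measure Ω) (𝓕 : Filtration ℕ mΩ)
    (X Z : ℕ → Ω → ℝ) (h : ℕ → ℝ → ℝ) (b : ℕ → ℝ) (ε r C : ℝ) : Prop where
  adapted : ∀ n ≥ 1, Measurable[𝓕 n] (X n)
  meas : ∀ n ≥ 1, Measurable (Z n)
  bound : ∀ n ≥ 1, ∀ᵐ ω ∂P, |Z n ω - ε| ≤ C
  mem : ∀ n ≥ 1, ∀ ω, X n ω ∈ Set.Icc 0 r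
  next : ∀ n ≥ 1, ∀ ω, X (n + 1) ω = min r (max (X n ω + b n * (Z n ω - ε)) 0)
  meas_mean : ∀ n ≥ 1, Measurable (h n)
  bound_mean : ∀ n ≥ 1, ∀ x, |h n x - ε| ≤ C
  mean : ∀ n ≥ 1, P[Z n | 𝓕 n] =ᵐ[P] fun ω => h n (X n ω)

namespace IsProjectedRM

variable {Ω : Type*} {mΩ : MeasurableSpace Ω} {P : Measure Ω}
  {𝓕 : Filtration ℕ mΩ} {X Z : ℕ → Ω → ℝ} {h : ℕ → ℝ → ℝ} {b : ℕ → ℝ} {ε r C : ℝ}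

lemma abs_excess_le (H : IsProjectedRM P 𝓕 X Z h b ε r C) {a a' : ℝ} (ha : a ∈ Set.Icc 0 r)
    (haa' : a ≤ a') {n : ℕ} (hn : 1 ≤ n) (ω : Ω) : |excess a a' (X n ω)| ≤ r := by
  refine (_root_.abs_excess_le a _ ⟨le_rfl, haa'⟩).trans ?_
  have := H.mem n hn ω
  rw [abs_le]
  constructor <;> linarith [ha.1, ha.2, this.1, this.2]

lemma measurable_excess (H : IsProjectedRM P 𝓕 X Z h b ε r C) (a a' : ℝ) {n : ℕ} (hn : 1 ≤ n) :
    Measurable[𝓕 n] (fun ω => excess a a' (X n ω)) :=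
  (continuous_excess a a').measurable.comp (H.adapted n hn)

lemma measurable_drift (H : IsProjectedRM P 𝓕 X Z h b ε r C) (a a' : ℝ) {n : ℕ} (hn : 1 ≤ n) :
    Measurable[𝓕 n] (fun ω => excess a a' (X n ω) * (h n (X n ω) - ε)) :=
  (H.measurable_excess a a' hn).mul
    (((H.meas_mean n hn).comp (H.adapted n hn)).sub measurable_const)

lemma integrable_excess_sq [IsProbabilityMeasure P]
    (H : IsProjectedRM P 𝓕 X Z h b ε r C) {a a' : ℝ}
    (ha : a ∈ Set.Icc 0 r) (haa' : a ≤ a') {n : ℕ} (hn : 1 ≤ n) :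
    Integrable (fun ω => excess a a' (X n ω) ^ 2) P := by
  refine Integrable.of_bound (((H.measurable_excess a a' hn).mono (𝓕.le n) le_rfl).pow_const
    2).aestronglyMeasurable (r ^ 2) (Eventually.of_forall fun ω => ?_)
  rw [Real.norm_eq_abs, abs_pow]
  exact pow_le_pow_left₀ (abs_nonneg _) (H.abs_excess_le ha haa' hn ω) 2

lemma integrable_drift [IsProbabilityMeasure P]
    (H : IsProjectedRM P 𝓕 X Z h b ε r C) {a a' : ℝ}
    (ha : a ∈ Set.Icc 0 r) (haa' : a ≤ a') {n : ℕ} (hn : 1 ≤ n) :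
    Integrable (fun ω => excess a a' (X n ω) * (h n (X n ω) - ε)) P := by
  refine Integrable.of_bound ((H.measurable_drift a a' hn).mono (𝓕.le n)
    le_rfl).aestronglyMeasurable (r * C) (Eventually.of_forall fun ω => ?_)
  rw [Real.norm_eq_abs, abs_mul]
  exact mul_le_mul (H.abs_excess_le ha haa' hn ω) (H.bound_mean n hn _) (abs_nonneg _)
    (ha.1.trans ha.2)

/-- The one-step inequality for the squared distance from an interval. -/
theorem condExp_excess_sq_le [IsProbabilityMeasure P]
    (H : IsProjectedRM P 𝓕 X Z h b ε r C) {a a' : ℝ}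
    (ha : a ∈ Set.Icc 0 r) (haa' : a ≤ a') {n : ℕ} (hn : 1 ≤ n) :
    P[fun ω => excess a a' (X (n + 1) ω) ^ 2 | 𝓕 n] ≤ᵐ[P] fun ω => excess a a' (X n ω) ^ 2
      + 2 * b n * (excess a a' (X n ω) * (h n (X n ω) - ε)) + b n ^ 2 * C ^ 2 := by
  -- The bound is written as f₀ + f₁ Z with f₀ and f₁ known at time n, so that f₁ can be pulled out
  -- of the conditional expectation.
  let f₀ : Ω → ℝ := fun ω => excess a a' (X n ω) ^ 2 - 2 * b n * ε * excess a a' (X n ω)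
    + b n ^ 2 * C ^ 2
  let f₁ : Ω → ℝ := fun ω => 2 * b n * excess a a' (X n ω)
  have hmeas := H.measurable_excess a a' hn
  have hf₀ : StronglyMeasurable[𝓕 n] f₀ := by
    refine Measurable.stronglyMeasurable ?_
    exact ((hmeas.pow_const 2).sub (hmeas.const_mul _)).add_const _
  have hf₁ : StronglyMeasurable[𝓕 n] f₁ := (hmeas.const_mul _).stronglyMeasurable
  have hE : Integrable (fun ω => excess a a' (X n ω)) P :=
    Integrable.of_bound (hmeas.mono (𝓕.le n) le_rfl).aestronglyMeasurable r
      (Eventually.of_forall fun ω => H.abs_excess_le ha haa' hn ω)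
  have hf₀i : Integrable f₀ P :=
    ((H.integrable_excess_sq ha haa' hn).sub (hE.const_mul _)).add (integrable_const _)
  have hf₁b : ∀ᵐ ω ∂P, ‖f₁ ω‖ ≤ |2 * b n| * r := Eventually.of_forall fun ω => by
    rw [Real.norm_eq_abs, abs_mul]
    exact mul_le_mul_of_nonneg_left (H.abs_excess_le ha haa' hn ω) (abs_nonneg _)
  have hZ : Integrable (Z n) P := by
    refine Integrable.of_bound (H.meas n hn).aestronglyMeasurable (C + |ε|) ?_
    filter_upwards [H.bound n hn] with ω hω
    have := abs_add_le (Z n ω - ε) ε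
    rw [sub_add_cancel] at this
    exact this.trans (by linarith)
  have hf₁Z : Integrable (f₁ * Z n) P :=
    hZ.bdd_mul (hf₁.mono (𝓕.le n)).aestronglyMeasurable hf₁b
  have hle : (fun ω => excess a a' (X (n + 1) ω) ^ 2) ≤ᵐ[P] f₀ + f₁ * Z n := by
    filter_upwards [H.bound n hn] with ω hω
    rw [H.next n hn]
    refine (excess_proj_sq_le haa' ha _).trans ((excess_add_sq_le haa' _ _).trans ?_)
    have h1 : (b n * (Z n ω - ε)) ^ 2 ≤ b n ^ 2 * C ^ 2 := by
      rw [mul_pow]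
      refine mul_le_mul_of_nonneg_left ?_ (sq_nonneg _)
      rw [← sq_abs]
      exact pow_le_pow_left₀ (abs_nonneg _) hω 2
    simp only [Pi.add_apply, Pi.mul_apply, f₀, f₁]
    nlinarith
  have hmono := condExp_mono (m := 𝓕 n)
    (H.integrable_excess_sq ha haa' (Nat.le_succ_of_le hn)) (hf₀i.add hf₁Z) hle
  filter_upwards [hmono, condExp_add hf₀i hf₁Z (𝓕 n), H.mean n hn,
    condExp_stronglyMeasurable_mul_of_bound (𝓕.le n) hf₁ hZ _ hf₁b] with ω h1 h2 h3 h4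
  refine h1.trans (le_of_eq ?_)
  rw [h2, Pi.add_apply, h4, Pi.mul_apply, h3, condExp_of_stronglyMeasurable (𝓕.le n) hf₀ hf₀i]
  simp only [f₀, f₁]
  ring

end IsProjectedRM

lemma excess_cases {a b : ℝ} (hab : a ≤ b) (x : ℝ) :
    (excess a b x = x - b ∧ b ≤ x) ∨ (excess a b x = 0 ∧ a ≤ x ∧ x ≤ b) ∨
      (excess a b x = x - a ∧ x ≤ a) := by
  unfold excess
  rcases le_total b x with h | h
  · left
    rw [max_eq_left (by linarith), max_eq_right (by linarith)]
    exact ⟨sub_zero _, h⟩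
  rcases le_total x a with h' | h'
  · right; right
    rw [max_eq_right (by linarith), max_eq_left (by linarith)]
    exact ⟨by ring, h'⟩
  · right; left
    rw [max_eq_right (by linarith), max_eq_right (by linarith)]
    exact ⟨sub_zero _, h', h⟩

lemma abs_sub_le_abs_excess_add {a b : ℝ} (hab : a ≤ b) (x : ℝ) :
    |x - a| ≤ |excess a b x| + (b - a) := by
  have h := sub_excess_mem hab x
  have h1 := neg_abs_le (excess a b x)
  have h2 := le_abs_self (excess a b x)
  rw [abs_le]
  constructor <;> linarith [h.1, h.2]

lemma not_summable_of_tendsto_sum_Icc {b : ℕ → ℝ}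
    (hb_sum : Tendsto (fun n => ∑ i ∈ Finset.Icc 1 n, b i) atTop atTop) : ¬ Summable b := by
  intro hs
  have h1 := (hs.hasSum.tendsto_sum_nat.comp (tendsto_add_atTop_nat 1)).sub_const (b 0)
  refine not_tendsto_nhds_of_tendsto_atTop hb_sum _ (h1.congr fun n => ?_)
  rw [Function.comp_apply, Finset.sum_range_succ', add_sub_cancel_right,
    Finset.range_eq_Ico, Finset.sum_Ico_add' (fun i => b i) 0 n 1]
  rfl

namespace IsProjectedRM

variable {Ω : Type*} {mΩ : MeasurableSpace Ω} {P : Measure Ω}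
  {𝓕 : Filtration ℕ mΩ} {X Z : ℕ → Ω → ℝ} {h : ℕ → ℝ → ℝ} {b : ℕ → ℝ} {ε r C : ℝ}

/-- The iterates corrected by the accumulated drift are a supermartingale. -/
lemma supermartingale_corrected [IsProbabilityMeasure P] (H : IsProjectedRM P 𝓕 X Z h b ε r C)
    {a a' : ℝ} (ha : a ∈ Set.Icc 0 r) (haa' : a ≤ a') {n₀ : ℕ} (hn₀ : 1 ≤ n₀)
    (𝓖 : Filtration ℕ mΩ) (h𝓖 : ∀ n, 𝓖 n = 𝓕 (n₀ + n)) :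
    Supermartingale (fun n ω => excess a a' (X (n₀ + n) ω) ^ 2
      + ∑ k ∈ Finset.range n, (-(2 * b (n₀ + k)
          * (excess a a' (X (n₀ + k) ω) * (h (n₀ + k) (X (n₀ + k) ω) - ε)))
        - b (n₀ + k) ^ 2 * C ^ 2)) 𝓖 P := by
  have hone : ∀ k, 1 ≤ n₀ + k := fun k => hn₀.trans (Nat.le_add_right _ _)
  let D : ℕ → Ω → ℝ := fun k ω => -(2 * b (n₀ + k)
          * (excess a a' (X (n₀ + k) ω) * (h (n₀ + k) (X (n₀ + k) ω) - ε)))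
        - b (n₀ + k) ^ 2 * C ^ 2
  have hDm : ∀ k n, k ≤ n → Measurable[𝓖 n] (D k) := fun k n hkn => by
    refine Measurable.mono (ma := 𝓖 k) ?_ (𝓖.mono hkn) le_rfl
    rw [h𝓖]
    exact ((H.measurable_drift a a' (hone k)).const_mul _).neg.sub_const _
  have hDi : ∀ k, Integrable (D k) P := fun k =>
    ((H.integrable_drift ha haa' (hone k)).const_mul _).neg.sub (integrable_const _)
  have hEm : ∀ n, Measurable[𝓖 n] fun ω => excess a a' (X (n₀ + n) ω) ^ 2 := fun n => by
    rw [h𝓖]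
    exact (H.measurable_excess a a' (hone n)).pow_const 2
  have hEi : ∀ n, Integrable (fun ω => excess a a' (X (n₀ + n) ω) ^ 2) P := fun n =>
    H.integrable_excess_sq ha haa' (hone n)
  -- The range n ≤ N + 1 records predictability: the correction at time N + 1 is already known at
  -- time N.
  have hTm : ∀ n N, n ≤ N + 1 →
      StronglyMeasurable[𝓖 N] (fun ω => ∑ k ∈ Finset.range n, D k ω) := fun n N hn =>
    (Finset.measurable_sum _ fun k hk =>
      hDm k N (by have := Finset.mem_range.mp hk; omega)).stronglyMeasurable
  have hTi : ∀ n, Integrable (fun ω => ∑ k ∈ Finset.range n, D k ω) P := fun n =>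
    integrable_finsetSum _ fun k _ => hDi k
  refine supermartingale_nat (fun n => ?_) (fun n => (hEi n).add (hTi n)) fun n => ?_
  · exact (hEm n).stronglyMeasurable.add (hTm n n n.le_succ)
  · have h1 := H.condExp_excess_sq_le ha haa' (hone n)
    rw [← h𝓖] at h1
    filter_upwards [h1, condExp_add (hEi (n + 1)) (hTi (n + 1)) (𝓖 n)] with ω h1 h2
    refine (le_of_eq h2).trans ?_
    rw [Pi.add_apply, condExp_of_stronglyMeasurable (𝓖.le n) (hTm (n + 1) n le_rfl) (hTi _)]
    beta_reduce
    rw [Finset.sum_range_succ]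
    have h3 : P[fun ω => excess a a' (X (n₀ + (n + 1)) ω) ^ 2 | 𝓖 n] ω
        ≤ excess a a' (X (n₀ + n) ω) ^ 2 + 2 * b (n₀ + n) * (excess a a' (X (n₀ + n) ω)
          * (h (n₀ + n) (X (n₀ + n) ω) - ε)) + b (n₀ + n) ^ 2 * C ^ 2 := h1
    simp only [D] at h3 ⊢
    linarith

/-- The iterates approach any interval towards which the drift points. -/
lemma tendsto_excess [IsProbabilityMeasure P] (H : IsProjectedRM P 𝓕 X Z h b ε r C) {θ : ℝ}
    (hθ : θ ∈ Set.Icc 0 r) (hb : ∀ n ≥ 1, 0 < b n)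
    (hb_sum : Tendsto (fun n => ∑ i ∈ Finset.Icc 1 n, b i) atTop atTop)
    (hb_sq : Summable (fun n => b n ^ 2))
    (hlow : ∀ n ≥ 1, ∀ y ∈ Set.Icc 0 r, y ≤ θ → ε ≤ h n y)
    (hdrift : ∀ δ > 0, ∃ η > 0, ∀ᶠ n in atTop, ∀ y ∈ Set.Icc 0 r,
      (θ + δ ≤ y → h n y ≤ ε - η) ∧ (y ≤ θ - δ → ε + η ≤ h n y)) {δ : ℝ} (hδ : 0 < δ) :
    ∀ᵐ ω ∂P, Tendsto (fun n => excess θ (θ + δ) (X n ω)) atTop (𝓝 0) := by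
  have hab : θ ≤ θ + δ := by linarith
  obtain ⟨η, hη, hev⟩ := hdrift δ hδ
  obtain ⟨n₁, hn₁⟩ := eventually_atTop.mp hev
  set n₀ := max n₁ 1
  have hn₀ : 1 ≤ n₀ := le_max_right _ _
  have hone : ∀ k, 1 ≤ n₀ + k := fun k => hn₀.trans (Nat.le_add_right _ _)
  let d : ℕ → Ω → ℝ := fun k ω =>
    excess θ (θ + δ) (X (n₀ + k) ω) * (h (n₀ + k) (X (n₀ + k) ω) - ε)
  -- Left of θ the drift has the right sign for every n, and beyond θ + δ for late n. In between the
  -- bias may spoil the sign, but there the excess is 0.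
  have hd : ∀ k ω, d k ω ≤ 0 := by
    intro k ω
    have hmem := H.mem _ (hone k) ω
    rcases excess_cases hab (X (n₀ + k) ω) with ⟨h1, h2⟩ | ⟨h1, h2⟩ | ⟨h1, h2⟩
    · have h3 := (hn₁ (n₀ + k) ((le_max_left _ _).trans (Nat.le_add_right _ _)) _ hmem).1 h2
      simp only [d, h1]
      exact mul_nonpos_of_nonneg_of_nonpos (by linarith) (by linarith)
    · simp only [d, h1, zero_mul, le_refl]
    · have h3 := hlow _ (hone k) _ hmem h2
      simp only [d, h1]
      exact mul_nonpos_of_nonpos_of_nonneg (by linarith) (by linarith)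
  let 𝓖 : Filtration ℕ mΩ :=
    ⟨fun n => 𝓕 (n₀ + n), fun i j hij => 𝓕.mono (Nat.add_le_add_left hij n₀), fun n => 𝓕.le _⟩
  have hS := H.supermartingale_corrected hθ hab hn₀ 𝓖 fun _ => rfl
  set S : ℕ → Ω → ℝ := fun n ω => excess θ (θ + δ) (X (n₀ + n) ω) ^ 2
      + ∑ k ∈ Finset.range n, (-(2 * b (n₀ + k) * (excess θ (θ + δ) (X (n₀ + k) ω)
        * (h (n₀ + k) (X (n₀ + k) ω) - ε))) - b (n₀ + k) ^ 2 * C ^ 2)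
  have hSeq : ∀ n ω, S n ω = excess θ (θ + δ) (X (n₀ + n) ω) ^ 2
      + ∑ k ∈ Finset.range n, 2 * b (n₀ + k) * (-d k ω)
      - (∑ k ∈ Finset.range n, b (n₀ + k) ^ 2) * C ^ 2 := by
    intro n ω
    simp only [S, d]
    rw [Finset.sum_sub_distrib, Finset.sum_mul]
    simp_rw [mul_neg]
    ring
  have hb_sq' : Summable fun k => b (n₀ + k) ^ 2 := by
    have := (summable_nat_add_iff n₀).mpr hb_sq
    exact this.congr fun k => by rw [add_comm]
  set B := ∑' k, b (n₀ + k) ^ 2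
  have hB : ∀ n, ∑ k ∈ Finset.range n, b (n₀ + k) ^ 2 ≤ B := fun n =>
    hb_sq'.sum_le_tsum _ fun _ _ => sq_nonneg _
  have hterm : ∀ k ω, 0 ≤ 2 * b (n₀ + k) * (-d k ω) := fun k ω =>
    mul_nonneg (by have := hb _ (hone k); linarith) (by have := hd k ω; linarith)
  -- A supermartingale bounded below is bounded in L¹, hence converges almost surely.
  have hSlow : ∀ n ω, -(B * C ^ 2) ≤ S n ω := by
    intro n ω
    rw [hSeq]
    have h1 := Finset.sum_nonneg fun k (_ : k ∈ Finset.range n) => hterm k ω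
    have h2 := mul_le_mul_of_nonneg_right (hB n) (sq_nonneg C)
    have h3 := sq_nonneg (excess θ (θ + δ) (X (n₀ + n) ω))
    linarith
  have hSint : ∀ n, ∫ ω, S n ω ∂P ≤ r ^ 2 := by
    intro n
    have h1 := hS.setIntegral_le (Nat.zero_le n) (MeasurableSet.univ (m := 𝓖 0))
    simp only [Measure.restrict_univ] at h1
    refine h1.trans ?_
    have h2 : ∀ ω, S 0 ω ≤ r ^ 2 := fun ω => by
      simp only [S, Finset.range_zero, Finset.sum_empty, add_zero]
      rw [← sq_abs]
      exact pow_le_pow_left₀ (abs_nonneg _) (H.abs_excess_le hθ hab hn₀ ω) 2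
    calc ∫ ω, S 0 ω ∂P ≤ ∫ _, r ^ 2 ∂P := integral_mono (hS.integrable 0) (integrable_const _) h2
      _ = r ^ 2 := by simp
  have hbdd : ∀ n, eLpNorm ((-S) n) 1 P ≤ ((r ^ 2 + 2 * (B * C ^ 2)).toNNReal : ℝ≥0) := by
    intro n
    rw [Pi.neg_apply, eLpNorm_neg, eLpNorm_one_eq_lintegral_enorm,
      ← ofReal_integral_norm_eq_lintegral_enorm (hS.integrable n)]
    refine ENNReal.ofReal_le_ofReal ?_
    have hB0 : 0 ≤ B := tsum_nonneg fun _ => sq_nonneg _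
    have h1 : ∀ ω, ‖S n ω‖ ≤ S n ω + 2 * (B * C ^ 2) := fun ω => by
      have h2 := hSlow n ω
      have h3 : 0 ≤ B * C ^ 2 := by positivity
      rw [Real.norm_eq_abs, abs_le]
      constructor <;> linarith
    calc ∫ ω, ‖S n ω‖ ∂P ≤ ∫ ω, (S n ω + 2 * (B * C ^ 2)) ∂P :=
          integral_mono (hS.integrable n).norm ((hS.integrable n).add (integrable_const _)) h1
      _ = ∫ ω, S n ω ∂P + 2 * (B * C ^ 2) := by
          rw [integral_add (hS.integrable n) (integrable_const _)]
          simp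
      _ ≤ _ := by linarith [hSint n]
  filter_upwards [hS.neg.exists_ae_tendsto_of_bdd hbdd] with ω ⟨c, hc⟩
  have hSω : Tendsto (fun n => S n ω) atTop (𝓝 (-c)) := by
    simpa using hc.neg
  obtain ⟨K, hK⟩ := hSω.bddAbove_range
  have hsumm : Summable fun k => 2 * b (n₀ + k) * (-d k ω) := by
    refine summable_of_sum_range_le (c := K + B * C ^ 2) (fun k => hterm k ω) fun n => ?_
    have h1 : S n ω ≤ K := hK ⟨n, rfl⟩
    rw [hSeq] at h1
    have h2 := mul_le_mul_of_nonneg_right (hB n) (sq_nonneg C)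
    have h3 := sq_nonneg (excess θ (θ + δ) (X (n₀ + n) ω))
    linarith
  have hV : ∃ L, Tendsto (fun n => excess θ (θ + δ) (X (n₀ + n) ω) ^ 2) atTop (𝓝 L) := by
    refine ⟨_, ((hSω.sub hsumm.hasSum.tendsto_sum_nat).add
      (hb_sq'.hasSum.tendsto_sum_nat.mul_const (C ^ 2))).congr fun n => ?_⟩
    rw [hSeq]
    ring
  obtain ⟨L, hL⟩ := hV
  have hL0 : L = 0 := by
    by_contra hne
    have hLpos : 0 < L := lt_of_le_of_ne (ge_of_tendsto' hL fun n => sq_nonneg _) (Ne.symm hne)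
    -- If L > 0, the iterates are eventually at distance more than ρ from the interval. The drift
    -- hypothesis, used with ρ in place of δ, bounds `-d` away from 0, so the summability of b·(-d)
    -- would give Σ b < ∞.
    set ρ := √(L / 2)
    have hρ : 0 < ρ := Real.sqrt_pos.mpr (by linarith)
    have hρ2 : ρ ^ 2 = L / 2 := Real.sq_sqrt (by linarith)
    obtain ⟨η', hη', hev'⟩ := hdrift ρ hρ
    have hev'' : ∀ᶠ k in atTop, ∀ y ∈ Set.Icc 0 r,
        (θ + ρ ≤ y → h (n₀ + k) y ≤ ε - η') ∧ (y ≤ θ - ρ → ε + η' ≤ h (n₀ + k) y) := by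
      have := (tendsto_add_atTop_nat n₀).eventually hev'
      filter_upwards [this] with k hk
      rwa [add_comm k n₀] at hk
    have hlarge : ∀ᶠ k in atTop, ρ * η' ≤ -d k ω := by
      filter_upwards [hev'', hL.eventually (lt_mem_nhds (show L / 2 < L by linarith))] with k h1 h2
      have hmem := H.mem _ (hone k) ω
      rw [← hρ2] at h2
      have h3 := sq_lt_sq.mp h2
      rw [abs_of_pos hρ] at h3
      rcases excess_cases hab (X (n₀ + k) ω) with ⟨e1, e2⟩ | ⟨e1, -⟩ | ⟨e1, e2⟩
      · rw [e1, abs_of_nonneg (by linarith)] at h3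
        have h4 := (h1 _ hmem).1 (by linarith)
        simp only [d, e1]
        rw [← mul_neg]
        exact mul_le_mul h3.le (by linarith) hη'.le (by linarith)
      · rw [e1, abs_zero] at h3
        exact absurd h3 (not_lt.mpr hρ.le)
      · rw [e1, abs_of_nonpos (by linarith)] at h3
        have h4 := (h1 _ hmem).2 (by linarith)
        simp only [d, e1]
        rw [← neg_mul]
        exact mul_le_mul h3.le (by linarith) hη'.le (by linarith)
    have hbs : Summable fun k => b (n₀ + k) := by
      have h1 : Summable fun k => 2 * b (n₀ + k) * (-d k ω) / (2 * (ρ * η')) :=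
        hsumm.div_const _
      refine Summable.of_norm_bounded_eventually_nat h1 ?_
      filter_upwards [hlarge] with k hk
      have hbk := hb _ (hone k)
      rw [Real.norm_eq_abs, abs_of_pos hbk, le_div_iff₀ (by positivity)]
      nlinarith
    refine not_summable_of_tendsto_sum_Icc hb_sum ((summable_nat_add_iff n₀).mp ?_)
    exact hbs.congr fun k => by rw [add_comm]
  rw [hL0] at hL
  have h1 : Tendsto (fun n => excess θ (θ + δ) (X n ω) ^ 2) atTop (𝓝 0) := by
    rw [← tendsto_add_atTop_iff_nat n₀]
    exact hL.congr fun n => by rw [add_comm n₀ n]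
  have h2 := (Real.continuous_sqrt.tendsto 0).comp h1
  rw [Real.sqrt_zero] at h2
  rw [tendsto_zero_iff_abs_tendsto_zero]
  exact h2.congr fun n => Real.sqrt_sq_eq_abs _

/-- Almost sure convergence of the projected Robbins–Monro iterates. -/
theorem tendsto_root [IsProbabilityMeasure P] (H : IsProjectedRM P 𝓕 X Z h b ε r C) {θ : ℝ}
    (hθ : θ ∈ Set.Icc 0 r) (hb : ∀ n ≥ 1, 0 < b n)
    (hb_sum : Tendsto (fun n => ∑ i ∈ Finset.Icc 1 n, b i) atTop atTop)
    (hb_sq : Summable (fun n => b n ^ 2))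
    (hlow : ∀ n ≥ 1, ∀ y ∈ Set.Icc 0 r, y ≤ θ → ε ≤ h n y)
    (hdrift : ∀ δ > 0, ∃ η > 0, ∀ᶠ n in atTop, ∀ y ∈ Set.Icc 0 r,
      (θ + δ ≤ y → h n y ≤ ε - η) ∧ (y ≤ θ - δ → ε + η ≤ h n y)) :
    ∀ᵐ ω ∂P, Tendsto (fun n => X n ω) atTop (𝓝 θ) := by
  -- Countably many widths δ = 1/(m + 1) keep the exceptional set null.
  have hall : ∀ᵐ ω ∂P, ∀ m : ℕ,
      Tendsto (fun n => excess θ (θ + 1 / ((m : ℝ) + 1)) (X n ω)) atTop (𝓝 0) :=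
    ae_all_iff.mpr fun m => H.tendsto_excess hθ hb hb_sum hb_sq hlow hdrift (by positivity)
  filter_upwards [hall] with ω hω
  rw [Metric.tendsto_atTop]
  intro γ hγ
  obtain ⟨m, hm⟩ := exists_nat_one_div_lt (half_pos hγ)
  obtain ⟨n₀, hn₀⟩ := Metric.tendsto_atTop.mp (hω m) (γ / 2) (half_pos hγ)
  refine ⟨n₀, fun n hn => ?_⟩
  have h1 := hn₀ n hn
  rw [Real.dist_eq, sub_zero] at h1
  have hpos : (0 : ℝ) < 1 / ((m : ℝ) + 1) := by positivity
  have h2 := abs_sub_le_abs_excess_add (show θ ≤ θ + 1 / ((m : ℝ) + 1) by linarith) (X n ω)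
  rw [Real.dist_eq]
  linarith

end IsProjectedRM

/-! ### The rate of convergence -/

lemma rpow_neg_mul_le_rpow_neg_succ {r : ℝ} (hr0 : 0 ≤ r) (hr1 : r ≤ 1) {n : ℕ} (hn : 1 ≤ n) :
    (n : ℝ) ^ (-r) * (1 - r / n) ≤ ((n + 1 : ℕ) : ℝ) ^ (-r) := by
  have hn0 : (0 : ℝ) < n := by exact_mod_cast hn
  have h1 : ((n + 1 : ℕ) : ℝ) = n * (1 + 1 / n) := by
    push_cast
    field_simp
  -- Bernoulli's inequality for exponents at most 1; the claim then reduces to (1 - q)(1 + q) ≤ 1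
  -- with q = r/n.
  have h2 : (1 + 1 / (n : ℝ)) ^ r ≤ 1 + r * (1 / n) :=
    rpow_one_add_le_one_add_mul_self (by have : 0 ≤ 1 / (n : ℝ) := by positivity
                                         linarith) hr0 hr1
  rw [h1, Real.mul_rpow hn0.le (by positivity), Real.rpow_neg (x := 1 + 1 / (n : ℝ)) (by positivity)]
  refine mul_le_mul_of_nonneg_left ?_ (by positivity)
  have hpos : 0 < (1 + 1 / (n : ℝ)) ^ r := by positivity
  rw [← one_div, le_div_iff₀ hpos]
  have hq : 0 ≤ r / (n : ℝ) := by positivity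
  rcases le_total (1 - r / (n : ℝ)) 0 with h | h
  · nlinarith
  · calc (1 - r / n) * (1 + 1 / (n : ℝ)) ^ r ≤ (1 - r / n) * (1 + r * (1 / n)) :=
          mul_le_mul_of_nonneg_left h2 h
      _ = 1 - (r / n) ^ 2 := by ring
      _ ≤ 1 := by nlinarith [sq_nonneg (r / (n : ℝ))]

/-- A version of Chung's lemma. -/
lemma exists_le_mul_rpow_of_recursion {e : ℕ → ℝ} {ω r p A : ℝ} (hω : 0 < ω) (hω1 : ω ≤ 1)
    (hr0 : 0 < r) (hr1 : r ≤ 1) (hp : r < p) (hA : 0 ≤ A) {n₀ : ℕ}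
    (h : ∀ n ≥ n₀, e (n + 1) ≤ (1 - p * (n : ℝ) ^ (-ω)) * e n + A * (n : ℝ) ^ (-ω - r)) :
    ∃ B : ℝ, 0 ≤ B ∧ ∃ n₁, ∀ n ≥ n₁, e n ≤ B * (n : ℝ) ^ (-r) := by
  have hlim : Tendsto (fun n : ℕ => p * (n : ℝ) ^ (-ω)) atTop (𝓝 (p * 0)) :=
    ((tendsto_rpow_neg_atTop hω).comp tendsto_natCast_atTop_atTop).const_mul p
  rw [mul_zero] at hlim
  obtain ⟨n₂, hn₂⟩ := eventually_atTop.mp (hlim.eventually (gt_mem_nhds one_pos))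
  set n₁ := max (max n₀ n₂) 1
  have hpr : 0 < p - r := by linarith
  -- The first entry starts the induction. The second gives A ≤ B(p - r), so the inhomogeneous term
  -- costs only the part p - r of the contraction rate p.
  refine ⟨max (e n₁ * (n₁ : ℝ) ^ r) (A / (p - r)), le_max_of_le_right (by positivity), n₁, ?_⟩
  set B := max (e n₁ * (n₁ : ℝ) ^ r) (A / (p - r))
  have hB0 : 0 ≤ B := le_max_of_le_right (by positivity)
  have hBA : A ≤ B * (p - r) := (div_le_iff₀ hpr).mp (le_max_right _ _)
  intro n hn
  induction n, hn using Nat.le_induction with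
  | base =>
    have hpos : (0 : ℝ) < n₁ := by exact_mod_cast (le_max_right _ _ : 1 ≤ n₁)
    calc e n₁ = e n₁ * (n₁ : ℝ) ^ r * (n₁ : ℝ) ^ (-r) := by
          rw [mul_assoc, ← Real.rpow_add hpos, add_neg_cancel, Real.rpow_zero, mul_one]
      _ ≤ _ := by
          gcongr
          exact le_max_left _ _
  | succ n hn ih =>
    have hn1 : 1 ≤ n := (le_max_right _ _).trans hn
    have hn0 : n₀ ≤ n := ((le_max_left _ _).trans (le_max_left _ _)).trans hn
    have hn2 : n₂ ≤ n := ((le_max_right _ _).trans (le_max_left _ _)).trans hn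
    have hpos : (0 : ℝ) < n := by exact_mod_cast hn1
    have hone : (1 : ℝ) ≤ n := by exact_mod_cast hn1
    set u := (n : ℝ) ^ (-ω)
    set w := (n : ℝ) ^ (-r)
    have hw : 0 < w := Real.rpow_pos_of_pos hpos _
    have huw : (n : ℝ) ^ (-ω - r) = u * w := by rw [sub_eq_add_neg, Real.rpow_add hpos]
    -- This uses ω ≤ 1: the remaining contraction r u is at least the relative decay r/n of n^{-r}.
    have hu : 1 / (n : ℝ) ≤ u := by
      rw [one_div, ← Real.rpow_neg_one]
      exact Real.rpow_le_rpow_of_exponent_le hone (by linarith)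
    have hu0 : 0 < u := Real.rpow_pos_of_pos hpos _
    calc e (n + 1) ≤ (1 - p * u) * e n + A * (u * w) := by
          rw [← huw]
          exact h n hn0
      _ ≤ (1 - p * u) * (B * w) + B * (p - r) * (u * w) := by
          have := hn₂ n hn2
          gcongr
      _ = B * (w * (1 - r * u)) := by ring
      _ ≤ B * (w * (1 - r / n)) := by
          have : r / n = r * (1 / n) := by ring
          rw [this]
          gcongr
      _ ≤ B * ((n + 1 : ℕ) : ℝ) ^ (-r) := by
          gcongr
          exact rpow_neg_mul_le_rpow_neg_succ hr0.le hr1 hn1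

namespace IsProjectedRM

variable {Ω : Type*} {mΩ : MeasurableSpace Ω} {P : Measure Ω}
  {𝓕 : Filtration ℕ mΩ} {X Z : ℕ → Ω → ℝ} {h : ℕ → ℝ → ℝ} {b : ℕ → ℝ} {ε r C : ℝ}

/-- The recursion for the mean squared error on the event that the iterates have stayed in the
domain where the drift is linearly bounded. -/
lemma setIntegral_sq_recursion [IsProbabilityMeasure P] (H : IsProjectedRM P 𝓕 X Z h b ε r C)
    {θ T m β τ : ℝ} (hθ : θ ∈ Set.Icc 0 r) (hτ : 0 < τ) {n : ℕ} (hn : 1 ≤ n) (hb : 0 < b n)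
    (hdrift : ∀ y ∈ Set.Icc 0 r, y < T →
      (y - θ) * (h n y - ε) ≤ -m * (y - θ) ^ 2 + β * |y - θ|)
    {G G' : Set Ω} (hG : MeasurableSet[𝓕 n] G) (hGT : ∀ ω ∈ G, X n ω < T) (hGG' : G' ⊆ G) :
    ∫ ω in G', (X (n + 1) ω - θ) ^ 2 ∂P ≤ (1 - (2 * m - τ) * b n) * ∫ ω in G, (X n ω - θ) ^ 2 ∂P
      + (b n * β ^ 2 / τ + b n ^ 2 * C ^ 2) := by
  have hex : ∀ k, (fun ω => (X k ω - θ) ^ 2) = fun ω => excess θ θ (X k ω) ^ 2 := fun k => by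
    funext ω
    rw [excess_self]
  have hi : ∀ k ≥ 1, Integrable (fun ω => (X k ω - θ) ^ 2) P := fun k hk => by
    rw [hex]
    exact H.integrable_excess_sq hθ le_rfl hk
  have hG' : MeasurableSet G := 𝓕.le n _ hG
  have hdi := H.integrable_drift hθ le_rfl hn
  simp only [excess_self] at hdi
  have hcond := H.condExp_excess_sq_le hθ le_rfl hn
  simp only [excess_self] at hcond
  have hc0 : 0 ≤ b n * β ^ 2 / τ + b n ^ 2 * C ^ 2 := by positivity
  calc ∫ ω in G', (X (n + 1) ω - θ) ^ 2 ∂P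
      ≤ ∫ ω in G, (X (n + 1) ω - θ) ^ 2 ∂P :=
        setIntegral_mono_set (hi _ (Nat.le_succ_of_le hn)).integrableOn
          (Eventually.of_forall fun ω => sq_nonneg _) hGG'.eventuallyLE
    _ = ∫ ω in G, (P[fun ω => (X (n + 1) ω - θ) ^ 2 | 𝓕 n]) ω ∂P :=
        (setIntegral_condExp (𝓕.le n) (hi _ (Nat.le_succ_of_le hn)) hG).symm
    _ ≤ ∫ ω in G, ((X n ω - θ) ^ 2 + 2 * b n * ((X n ω - θ) * (h n (X n ω) - ε))
          + b n ^ 2 * C ^ 2) ∂P :=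
        setIntegral_mono_ae integrable_condExp.integrableOn
          (((hi n hn).add (hdi.const_mul _)).add (integrable_const _)).integrableOn hcond
    _ ≤ ∫ ω in G, ((1 - (2 * m - τ) * b n) * (X n ω - θ) ^ 2
          + (b n * β ^ 2 / τ + b n ^ 2 * C ^ 2)) ∂P := by
        refine setIntegral_mono_on
          (((hi n hn).add (hdi.const_mul _)).add (integrable_const _)).integrableOn
          (((hi n hn).const_mul _).add (integrable_const _)).integrableOn hG' fun ω hω => ?_
        have h1 := hdrift _ (H.mem n hn ω) (hGT ω hω)
        -- Young's inequality: the bias costs a part τ of the contraction rate and a constant β²/τ.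
        have h2 : 2 * (β * |X n ω - θ|) ≤ τ * (X n ω - θ) ^ 2 + β ^ 2 / τ := by
          rw [← sq_abs (X n ω - θ)]
          have h3 : 0 ≤ (τ * |X n ω - θ| - β) ^ 2 / τ := by positivity
          have h4 : (τ * |X n ω - θ| - β) ^ 2 / τ
              = τ * |X n ω - θ| ^ 2 - 2 * (β * |X n ω - θ|) + β ^ 2 / τ := by
            field_simp
            ring
          linarith
        have h5 := mul_le_mul_of_nonneg_left h1 (show 0 ≤ 2 * b n by linarith)
        have h6 := mul_le_mul_of_nonneg_left h2 hb.le
        have h7 : b n * β ^ 2 / τ = b n * (β ^ 2 / τ) := by ring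
        rw [h7]
        nlinarith
    _ = (1 - (2 * m - τ) * b n) * ∫ ω in G, (X n ω - θ) ^ 2 ∂P
          + P.real G * (b n * β ^ 2 / τ + b n ^ 2 * C ^ 2) := by
        rw [integral_add ((hi n hn).const_mul _).integrableOn (integrable_const _).integrableOn,
          integral_const_mul, setIntegral_const, smul_eq_mul]
    _ ≤ _ := by
        gcongr
        exact mul_le_of_le_one_left hc0 measureReal_le_one

/-- The rate of convergence in probability of the projected Robbins–Monro iterates. -/
theorem rate [IsProbabilityMeasure P] (H : IsProjectedRM P 𝓕 X Z h b ε r C)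
    {θ T m K κ w c : ℝ} (hθ : θ ∈ Set.Icc 0 r) (hθT : θ < T)
    (hX : ∀ᵐ ω ∂P, Tendsto (fun n => X n ω) atTop (𝓝 θ)) (hw : 1 / 2 < w) (hw1 : w ≤ 1)
    (hm : 0 < m) (hc : (w - 1 / 2) / m < c) (hb : ∀ n ≥ 1, b n = c / (n : ℝ) ^ w)
    (hκ : w - 1 / 2 ≤ κ)
    (hdrift : ∀ᶠ n : ℕ in atTop, ∀ y ∈ Set.Icc 0 r, y < T →
      (y - θ) * (h n y - ε) ≤ -m * (y - θ) ^ 2 + K * (n : ℝ) ^ (-κ) * |y - θ|)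
    {η : ℝ} (hη : 0 < η) :
    ∃ M : ℝ, ∀ n : ℕ, 1 ≤ n →
      P {ω | M * (n : ℝ) ^ (-(w - 1 / 2)) < |X n ω - θ|} ≤ ENNReal.ofReal η := by
  have hc0 : 0 < c := lt_trans (div_pos (by linarith) hm) hc
  have hcm : 2 * w - 1 < 2 * m * c := by
    rw [div_lt_iff₀ hm] at hc
    linarith
  have hXm : ∀ n ≥ 1, Measurable (X n) := fun n hn => (H.adapted n hn).mono (𝓕.le n) le_rfl
  -- Since X n → θ < T almost surely, the events of reaching T after time N decrease to a null set.
  obtain ⟨N, hN⟩ : ∃ N : ℕ, P {ω | ∃ j ≥ N + 1, T ≤ X j ω} ≤ ENNReal.ofReal (η / 2) := by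
    have hA : ∀ N : ℕ, MeasurableSet {ω | ∃ j ≥ N + 1, T ≤ X j ω} := fun N => by
      have : {ω | ∃ j ≥ N + 1, T ≤ X j ω} = ⋃ j ∈ {j | N + 1 ≤ j}, {ω | T ≤ X j ω} := by
        ext ω
        simp
      rw [this]
      exact MeasurableSet.biUnion (Set.to_countable _) fun j hj =>
        measurableSet_le measurable_const (hXm j (le_trans (Nat.le_add_left 1 N) hj))
    have hanti : Antitone fun N : ℕ => {ω | ∃ j ≥ N + 1, T ≤ X j ω} := by
      rintro N N' hNN' ω ⟨j, hj, h⟩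
      exact ⟨j, le_trans (Nat.add_le_add_right hNN' 1) hj, h⟩
    have h0 : P (⋂ N : ℕ, {ω | ∃ j ≥ N + 1, T ≤ X j ω}) = 0 := by
      refine measure_mono_null (t := {ω | ¬ Tendsto (fun n => X n ω) atTop (𝓝 θ)}) ?_ hX
      intro ω hω htend
      obtain ⟨N, hN⟩ := eventually_atTop.mp (htend.eventually (gt_mem_nhds hθT))
      obtain ⟨j, hj, h⟩ := Set.mem_iInter.mp hω N
      exact absurd (hN j (by omega)) (not_lt.mpr h)
    have hlim := tendsto_measure_iInter_atTop (μ := P) (fun N => (hA N).nullMeasurableSet) hanti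
      ⟨0, measure_ne_top _ _⟩
    rw [h0] at hlim
    exact ((hlim.eventually (gt_mem_nhds (ENNReal.ofReal_pos.mpr (half_pos hη)))).exists).imp
      fun N h => le_of_lt h
  obtain ⟨n₂, hn₂⟩ := eventually_atTop.mp hdrift
  set n₀ := max (N + 1) n₂
  have hn₀ : 1 ≤ n₀ := le_trans (Nat.le_add_left 1 N) (le_max_left _ _)
  let G : ℕ → Set Ω := fun n => {ω | ∀ j ∈ Set.Icc n₀ n, X j ω < T}
  have hG : ∀ n, MeasurableSet[𝓕 n] (G n) := fun n => by
    have : G n = ⋂ j ∈ Set.Icc n₀ n, {ω | X j ω < T} := by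
      ext ω
      simp [G]
    rw [this]
    refine MeasurableSet.biInter (Set.to_countable _) fun j hj => ?_
    exact measurableSet_lt ((H.adapted j (hn₀.trans hj.1)).mono (𝓕.mono hj.2) le_rfl)
      measurable_const
  set r' : ℝ := 2 * w - 1
  have hr'0 : 0 < r' := by simp only [r']; linarith
  -- Chosen so that p is the midpoint of r' and 2mc, hence above r'.
  set τ : ℝ := (2 * m * c - r') / (2 * c)
  have hτ : 0 < τ := div_pos (by linarith) (by linarith)
  set p : ℝ := (2 * m - τ) * c
  have hp : r' < p := by
    have : p = m * c + r' / 2 := by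
      simp only [p, τ]
      field_simp
      ring
    rw [this]
    linarith
  set A : ℝ := c * K ^ 2 / τ + c ^ 2 * C ^ 2
  obtain ⟨B, hB0, n₁, hB⟩ := exists_le_mul_rpow_of_recursion
    (e := fun n => ∫ ω in G n, (X n ω - θ) ^ 2 ∂P) (ω := w) (r := r') (p := p) (A := A) (n₀ := n₀)
    (by linarith) hw1 hr'0 (by simp only [r']; linarith) hp (by positivity) (by
      intro n hn
      have hn1 : 1 ≤ n := hn₀.trans hn
      have hpos : (0 : ℝ) < n := by exact_mod_cast hn1
      have hone : (1 : ℝ) ≤ n := by exact_mod_cast hn1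
      have hbn : b n = c * (n : ℝ) ^ (-w) := by
        rw [hb n hn1, Real.rpow_neg hpos.le, div_eq_mul_inv]
      have hrec := H.setIntegral_sq_recursion hθ hτ hn1
        (hbn ▸ mul_pos hc0 (Real.rpow_pos_of_pos hpos _))
        (hn₂ n ((le_max_right _ _).trans hn)) (hG n) (G' := G (n + 1))
        (fun ω hω => hω n ⟨hn, le_rfl⟩) (fun ω hω j hj => hω j ⟨hj.1, Nat.le_succ_of_le hj.2⟩)
      refine hrec.trans (add_le_add (le_of_eq ?_) ?_)
      · rw [hbn]
        simp only [p]
        ring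
      -- The bias term is of the admissible order because κ ≥ w - 1/2, the noise term because w ≤ 1.
      · have h1 : (n : ℝ) ^ (-w) * ((n : ℝ) ^ (-κ)) ^ 2 ≤ (n : ℝ) ^ (-w - r') := by
          rw [← Real.rpow_natCast, ← Real.rpow_mul hpos.le, ← Real.rpow_add hpos]
          refine Real.rpow_le_rpow_of_exponent_le hone ?_
          push_cast
          simp only [r']
          linarith
        have h2 : ((n : ℝ) ^ (-w)) ^ 2 ≤ (n : ℝ) ^ (-w - r') := by
          rw [← Real.rpow_natCast, ← Real.rpow_mul hpos.le]
          refine Real.rpow_le_rpow_of_exponent_le hone ?_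
          push_cast
          simp only [r']
          linarith
        calc b n * (K * (n : ℝ) ^ (-κ)) ^ 2 / τ + b n ^ 2 * C ^ 2
            = c * K ^ 2 / τ * ((n : ℝ) ^ (-w) * ((n : ℝ) ^ (-κ)) ^ 2)
              + c ^ 2 * C ^ 2 * ((n : ℝ) ^ (-w)) ^ 2 := by
              rw [hbn]
              ring
          _ ≤ c * K ^ 2 / τ * (n : ℝ) ^ (-w - r') + c ^ 2 * C ^ 2 * (n : ℝ) ^ (-w - r') := by
              gcongr
          _ = A * (n : ℝ) ^ (-w - r') := by
              simp only [A]
              ring)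
  set n₃ := max n₀ n₁
  have hn₃ : (0 : ℝ) < n₃ := by exact_mod_cast hn₀.trans (le_max_left _ _)
  have hr0 : 0 ≤ r := hθ.1.trans hθ.2
  -- The root makes Markov's bound η/2 for n ≥ n₃. The second term makes the event empty for n < n₃,
  -- as |X n - θ| ≤ r. The last ensures M > 0.
  set M : ℝ := √(2 * B / η) + r * (n₃ : ℝ) ^ (w - 1 / 2) + 1
  have hM0 : 0 < M := by positivity
  have hMB : B / M ^ 2 ≤ η / 2 := by
    have h1 : √(2 * B / η) ≤ M := by
      have : 0 ≤ r * (n₃ : ℝ) ^ (w - 1 / 2) := by positivity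
      simp only [M]
      linarith
    have h2 := pow_le_pow_left₀ (Real.sqrt_nonneg _) h1 2
    rw [Real.sq_sqrt (by positivity), div_le_iff₀ hη] at h2
    rw [div_le_iff₀ (by positivity)]
    linarith
  refine ⟨M, fun n hn => ?_⟩
  have hpos : (0 : ℝ) < n := by exact_mod_cast hn
  set s : ℝ := (n : ℝ) ^ (-(w - 1 / 2))
  have hs : 0 < s := Real.rpow_pos_of_pos hpos _
  by_cases hnn : n < n₃
  · have hempty : {ω | M * s < |X n ω - θ|} = ∅ := by
      rw [Set.eq_empty_iff_forall_notMem]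
      intro ω hω
      have h1 : |X n ω - θ| ≤ r := by
        have := H.mem n hn ω
        rw [abs_le]
        constructor <;> linarith [hθ.1, hθ.2, this.1, this.2]
      have h2 : r ≤ M * s := by
        calc r = r * ((n₃ : ℝ) ^ (w - 1 / 2) * (n₃ : ℝ) ^ (-(w - 1 / 2))) := by
              rw [← Real.rpow_add hn₃, add_neg_cancel, Real.rpow_zero, mul_one]
          _ = r * (n₃ : ℝ) ^ (w - 1 / 2) * (n₃ : ℝ) ^ (-(w - 1 / 2)) := by ring
          _ ≤ M * s := by
              refine mul_le_mul ?_ ?_ (by positivity) hM0.le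
              · have := Real.sqrt_nonneg (2 * B / η)
                simp only [M]
                linarith
              · exact Real.rpow_le_rpow_of_nonpos hpos (by exact_mod_cast hnn.le) (by linarith)
      have h3 : M * s < |X n ω - θ| := hω
      linarith
    rw [hempty, measure_empty]
    exact zero_le
  · have hn3 : n₃ ≤ n := not_lt.mp hnn
    have hss : s ^ 2 = (n : ℝ) ^ (-r') := by
      simp only [s, r']
      rw [← Real.rpow_natCast, ← Real.rpow_mul hpos.le]
      congr 1
      push_cast
      ring
    have hGm : MeasurableSet (G n) := 𝓕.le n _ (hG n)
    have hsub : {ω | M * s < |X n ω - θ|}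
        ⊆ {ω | ∃ j ≥ N + 1, T ≤ X j ω} ∪ ({ω | (M * s) ^ 2 ≤ (X n ω - θ) ^ 2} ∩ G n) := by
      intro ω hω
      by_cases hGω : ω ∈ G n
      · right
        refine ⟨?_, hGω⟩
        have h1 : M * s < |X n ω - θ| := hω
        change (M * s) ^ 2 ≤ (X n ω - θ) ^ 2
        rw [← sq_abs (X n ω - θ)]
        exact pow_le_pow_left₀ (by positivity) h1.le 2
      · left
        simp only [G, Set.mem_ofPred_eq, not_forall, not_lt] at hGω
        obtain ⟨j, hj, h⟩ := hGω
        exact ⟨j, (le_max_left _ _).trans hj.1, h⟩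
    have hint : Integrable (fun ω => (X n ω - θ) ^ 2) P := by
      have := H.integrable_excess_sq hθ le_rfl hn
      simpa only [excess_self] using this
    have hmarkov : P ({ω | (M * s) ^ 2 ≤ (X n ω - θ) ^ 2} ∩ G n) ≤ ENNReal.ofReal (η / 2) := by
      have h1 := mul_meas_ge_le_integral_of_nonneg (μ := P.restrict (G n))
        (Eventually.of_forall fun ω => sq_nonneg (X n ω - θ)) hint.integrableOn ((M * s) ^ 2)
      have h2 : ∫ ω in G n, (X n ω - θ) ^ 2 ∂P ≤ B * s ^ 2 := by
        rw [hss]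
        exact hB n ((le_max_right _ _).trans hn3)
      rw [← Measure.restrict_apply' hGm]
      rw [← ENNReal.ofReal_toReal (measure_ne_top (P.restrict (G n)) _)]
      refine ENNReal.ofReal_le_ofReal (le_trans ?_ hMB)
      rw [le_div_iff₀ (by positivity)]
      have h3 := h1.trans h2
      have h4 : (P.restrict (G n)).real {ω | (M * s) ^ 2 ≤ (X n ω - θ) ^ 2} * M ^ 2 * s ^ 2
          ≤ B * s ^ 2 := by
        calc _ = (M * s) ^ 2 * (P.restrict (G n)).real
              {ω | (M * s) ^ 2 ≤ (X n ω - θ) ^ 2} := by ring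
          _ ≤ _ := h3
      exact le_of_mul_le_mul_right h4 (by positivity)
    calc P {ω | M * s < |X n ω - θ|}
        ≤ P {ω | ∃ j ≥ N + 1, T ≤ X j ω}
          + P ({ω | (M * s) ^ 2 ≤ (X n ω - θ) ^ 2} ∩ G n) :=
          (measure_mono hsub).trans (measure_union_le _ _)
      _ ≤ ENNReal.ofReal (η / 2) + ENNReal.ofReal (η / 2) := add_le_add hN hmarkov
      _ = ENNReal.ofReal η := by
          rw [← ENNReal.ofReal_add (by linarith) (by linarith), add_halves]

end IsProjectedRM

/-! ### The limit function of a monotone network, and the scheme as a Robbins–Monro recursion -/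

namespace McQN

variable {s d : ℕ} (N : McQN s d) {v : Fin d → ℝ≥0} {φ : N.State → ℝ}

instance (t θ : ℝ) : IsProbabilityMeasure (N.stateLaw v t θ) :=
  inferInstanceAs (IsProbabilityMeasure (PMF.toMeasure _))

instance (t θ : ℝ) : IsProbabilityMeasure (N.valueLaw v φ t θ) :=
  Measure.isProbabilityMeasure_map (Measurable.of_discrete (f := φ)).aemeasurable

lemma abs_meanAt_le {C : ℝ} (hC : ∀ ξ, |φ ξ| ≤ C) (t θ : ℝ) : |N.meanAt v φ t θ| ≤ C := by
  have := norm_integral_le_of_norm_le_const (μ := N.stateLaw v t θ) (f := φ) (C := C)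
    (Eventually.of_forall hC)
  simpa [meanAt] using this

lemma ae_abs_le_valueLaw {C : ℝ} (hC : ∀ ξ, |φ ξ| ≤ C) (t θ : ℝ) :
    ∀ᵐ y ∂(N.valueLaw v φ t θ), |y| ≤ C := by
  unfold valueLaw
  rw [ae_map_iff (Measurable.of_discrete (f := φ)).aemeasurable
    (measurableSet_le continuous_abs.measurable measurable_const)]
  exact Eventually.of_forall hC

lemma integral_valueLaw (t θ : ℝ) : ∫ y, y ∂(N.valueLaw v φ t θ) = N.meanAt v φ t θ :=
  integral_map (Measurable.of_discrete (f := φ)).aemeasurable measurable_id.aestronglyMeasurable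

namespace IsStochMonotone

variable {N}

/-- The means are bounded and non-increasing for t ≥ 0, so the limit in `meanLim` exists; `max t 0`
extends the monotonicity to the whole line. -/
lemma tendsto_meanAt (hφ : N.IsStochMonotone v φ) {θ : ℝ} (hθ : 0 ≤ θ) :
    Tendsto (fun t => N.meanAt v φ t θ) atTop (𝓝 (N.meanLim v φ θ)) := by
  obtain ⟨C, hC⟩ := hφ.bounded
  refine tendsto_nhds_limUnder ?_
  have hanti : Antitone fun t : ℝ => N.meanAt v φ (max t 0) θ := fun t t' htt' =>
    hφ.anti _ _ _ _ (le_max_right _ _) (max_le_max_right 0 htt') hθ le_rfl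
  have hbdd : BddBelow (Set.range fun t : ℝ => N.meanAt v φ (max t 0) θ) := by
    refine ⟨-C, ?_⟩
    rintro _ ⟨t, rfl⟩
    exact (abs_le.mp (N.abs_meanAt_le hC _ _)).1
  refine ⟨_, (tendsto_atTop_ciInf hanti hbdd).congr' ?_⟩
  filter_upwards [eventually_ge_atTop 0] with t ht
  rw [max_eq_left ht]

lemma meanLim_le_meanAt (hφ : N.IsStochMonotone v φ) {t θ : ℝ} (ht : 0 ≤ t) (hθ : 0 ≤ θ) :
    N.meanLim v φ θ ≤ N.meanAt v φ t θ := by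
  refine le_of_tendsto (hφ.tendsto_meanAt hθ) ?_
  filter_upwards [eventually_ge_atTop t] with t' ht'
  exact hφ.anti _ _ _ _ ht ht' hθ le_rfl

lemma meanLim_anti (hφ : N.IsStochMonotone v φ) {θ θ' : ℝ} (hθ : 0 ≤ θ) (h : θ ≤ θ') :
    N.meanLim v φ θ' ≤ N.meanLim v φ θ := by
  refine le_of_tendsto_of_tendsto (hφ.tendsto_meanAt (hθ.trans h)) (hφ.tendsto_meanAt hθ) ?_
  filter_upwards [eventually_ge_atTop 0] with t ht
  exact hφ.anti _ _ _ _ ht le_rfl hθ h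

/-- The limit bounds all means from below, so a positive limit prevents the escape of mass. -/
lemma mem_stableSet_of_meanLim_pos (hφ : N.IsStochMonotone v φ) (hv : v ≠ 0) {θ : ℝ} (hθ : 0 ≤ θ)
    (h : 0 < N.meanLim v φ θ) : θ ∈ N.stableSet v := by
  refine ⟨hθ, N.stable_of_meanAt_ge v hv φ hφ.bounded hφ.vanish h ?_⟩
  filter_upwards [eventually_ge_atTop 0] with t ht
  exact hφ.meanLim_le_meanAt ht hθ

/-- Either θ' is stable as well and strict monotonicity on Θ_s applies, or the limit at θ' is not
positive. -/
lemma meanLim_lt_of_lt (hφ : N.IsStochMonotone v φ) (hv : v ≠ 0) {θ θ' : ℝ} (hθ : 0 ≤ θ)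
    (hpos : 0 < N.meanLim v φ θ) (h : θ < θ') : N.meanLim v φ θ' < N.meanLim v φ θ := by
  rcases lt_or_ge 0 (N.meanLim v φ θ') with h' | h'
  · exact hφ.strictAnti (hφ.mem_stableSet_of_meanLim_pos hv hθ hpos)
      (hφ.mem_stableSet_of_meanLim_pos hv (hθ.trans h.le) h') h
  · exact h'.trans_lt hpos

/-- A lower bound for the modulus of the derivative bounds the decrease of the limit. -/
lemma meanLim_sub_le (hφ : N.IsStochMonotone v φ) {m T : ℝ} (hm : 0 < m)
    (hderiv : ∀ θ ∈ Set.Ioo 0 T, m ≤ |deriv (N.meanLim v φ) θ|) {x y : ℝ} (hx : 0 ≤ x)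
    (hxy : x ≤ y) (hy : y < T) :
    N.meanLim v φ y - N.meanLim v φ x ≤ -m * (y - x) := by
  -- Monotonicity fixes the sign of the derivative. Precomposing with `max z 0` gives a globally
  -- antitone function with the same germ at θ > 0.
  have hneg : ∀ θ ∈ Set.Ioo 0 T, deriv (N.meanLim v φ) θ ≤ -m := by
    intro θ hθ
    have h1 := hderiv θ hθ
    have hanti : Antitone fun z : ℝ => N.meanLim v φ (max z 0) := fun z z' hzz' =>
      hφ.meanLim_anti (le_max_right _ _) (max_le_max_right 0 hzz')
    have heq : N.meanLim v φ =ᶠ[𝓝 θ] fun z : ℝ => N.meanLim v φ (max z 0) := by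
      filter_upwards [lt_mem_nhds hθ.1] with z hz
      rw [max_eq_left hz.le]
    have h2 : deriv (N.meanLim v φ) θ ≤ 0 := by
      rw [heq.deriv_eq]
      exact hanti.deriv_nonpos
    rw [abs_of_nonpos h2] at h1
    linarith
  have hdiff : ∀ θ ∈ Set.Ioo 0 T, DifferentiableAt ℝ (N.meanLim v φ) θ := fun θ hθ =>
    differentiableAt_of_deriv_ne_zero ((hneg θ hθ).trans_lt (neg_lt_zero.mpr hm)).ne
  have hopen : ∀ x' y', 0 < x' → x' ≤ y' → y' < T →
      N.meanLim v φ y' - N.meanLim v φ x' ≤ -m * (y' - x') := by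
    intro x' y' hx' hxy' hy'
    refine (convex_Ioo 0 T).image_sub_le_mul_sub_of_deriv_le
      (fun θ hθ => (hdiff θ hθ).continuousAt.continuousWithinAt) ?_ ?_ x'
      ⟨hx', hxy'.trans_lt hy'⟩ y' ⟨hx'.trans_le hxy', hy'⟩ hxy'
    · rw [interior_Ioo]
      exact fun θ hθ => (hdiff θ hθ).differentiableWithinAt
    · rw [interior_Ioo]
      exact hneg
  rcases eq_or_lt_of_le hxy with rfl | hlt
  · simp
  -- The case x = 0 is reached by letting x' decrease to x; monotonicity replaces continuity at x.
  have hlim : Tendsto (fun x' : ℝ => -m * (y - x')) (𝓝[>] x) (𝓝 (-m * (y - x))) :=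
    (Continuous.tendsto (by fun_prop) x).mono_left nhdsWithin_le_nhds
  refine ge_of_tendsto hlim ?_
  filter_upwards [Ioo_mem_nhdsGT hlt] with x' hx'
  have h1 := hopen x' y (hx.trans_lt hx'.1) hx'.2.le hy
  have h2 := hφ.meanLim_anti hx hx'.1.le
  linarith

end IsStochMonotone

namespace IsScheme

variable {N} {ε x : ℝ} {t b : ℕ → ℝ} {Ω : Type*} [mΩ : MeasurableSpace Ω] {P : Measure Ω}
  {ϑ Z : ℕ → Ω → ℝ}

lemma measurable_iterate (H : N.IsScheme v φ ε x t b P ϑ Z) {n : ℕ} (hn : 1 ≤ n) :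
    Measurable (ϑ n) := by
  induction n, hn using Nat.le_induction with
  | base => exact (funext H.init : ϑ 1 = fun _ => x) ▸ measurable_const
  | succ n hn ih =>
    rw [show ϑ (n + 1) = _ from funext (H.next n hn)]
    exact measurable_const.min
      ((ih.add (((H.meas n hn).sub_const ε).const_mul (b n))).max measurable_const)

/-- The filtration generated by the iterates. -/
def filtration (H : N.IsScheme v φ ε x t b P ϑ Z) : Filtration ℕ mΩ where
  seq n := ⨆ j ∈ Finset.Icc 1 n, MeasurableSpace.comap (ϑ j) (borel ℝ)
  mono' _ _ hij := biSup_mono fun _ hk => Finset.Icc_subset_Icc_right hij hk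
  le' _ := iSup₂_le fun _ hj => (H.measurable_iterate (Finset.mem_Icc.mp hj).1).comap_le

/-- The iterates are nonnegative, so `max y 0` changes nothing along them, but it makes the mean
antitone on the line and thus measurable. The start lies in [0, θ̄] because stable parameters do. -/
lemma isProjectedRM [IsProbabilityMeasure P] (H : N.IsScheme v φ ε x t b P ϑ Z)
    (hφ : N.IsStochMonotone v φ) (hv : v ≠ 0) (ht : ∀ n ≥ 1, 0 < t n) (hx : x ∈ N.stableSet v)
    {C : ℝ} (hC : ∀ ξ, |φ ξ| ≤ C) :
    IsProjectedRM P H.filtration ϑ Z (fun n y => N.meanAt v φ (t n) (max y 0)) b ε (N.subcrit v)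
      (C + |ε|) := by
  have hr := N.subcrit_pos v hv
  have hmem : ∀ n ≥ 1, ∀ ω, ϑ n ω ∈ Set.Icc 0 (N.subcrit v) := by
    intro n hn ω
    obtain rfl | ⟨k, rfl, hk⟩ : n = 1 ∨ ∃ k, n = k + 1 ∧ 1 ≤ k := by
      rcases eq_or_lt_of_le hn with h | h
      · exact Or.inl h.symm
      · exact Or.inr ⟨n - 1, by omega, by omega⟩
    · rw [H.init]
      exact ⟨hx.1, N.le_subcrit_of_mem_stableSet v hv hx⟩
    · rw [H.next k hk]
      exact ⟨le_min hr.le (le_max_right _ _), min_le_left _ _⟩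
  have hlaw : ∀ n ≥ 1, _ := fun n hn => condExp_eq_integral_of_condLaw (H.filtration.le n)
    (H.meas n hn) (fun ω => N.valueLaw v φ (t n) (ϑ n ω)) C
    (fun ω => N.ae_abs_le_valueLaw hC _ _) (H.condLaw n hn)
  have hsub : ∀ y : ℝ, |y| ≤ C → |y - ε| ≤ C + |ε| := fun y hy =>
    (abs_sub y ε).trans (by linarith)
  refine ⟨fun n hn => ?_, H.meas, fun n hn => ?_, hmem, H.next, fun n hn => ?_, fun n _ y => ?_,
    fun n hn => ?_⟩
  · refine (comap_measurable (ϑ n)).mono ?_ le_rfl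
    exact le_iSup₂_of_le n (Finset.mem_Icc.mpr ⟨hn, le_rfl⟩) le_rfl
  · filter_upwards [(hlaw n hn).1] with ω hω
    exact hsub _ hω
  · refine Antitone.measurable fun y y' hyy' => ?_
    exact hφ.anti _ _ _ _ (ht n hn).le le_rfl (le_max_right _ _) (max_le_max_right 0 hyy')
  · exact hsub _ (N.abs_meanAt_le hC _ _)
  · filter_upwards [(hlaw n hn).2] with ω hω
    rw [hω, integral_valueLaw, max_eq_left (hmem n hn ω).1]

end IsScheme

end McQN

end

/-! ### Convergence and rate for the queueing network -/

theorem theorem1 {s d : ℕ} (N : McQN s d) (v : Fin d → ℝ≥0) (hv : v ≠ 0)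
    (φ : N.State → ℝ) (hφ : N.IsStochMonotone v φ)
    (ε θε : ℝ) (hε : 0 < ε) (hθε_nonneg : 0 ≤ θε) (hθε : N.meanLim v φ θε = ε)
    (x : ℝ) (hx : x ∈ N.stableSet v)
    (t b : ℕ → ℝ) (ht : ∀ n ≥ 1, 0 < t n) (hb : ∀ n ≥ 1, 0 < b n)
    (ht_lim : Tendsto t atTop atTop)
    (hb_sum : Tendsto (fun n => ∑ i ∈ Finset.Icc 1 n, b i) atTop atTop)
    (hb_sq : Summable (fun n => b n ^ 2))
    {Ω : Type*} [MeasurableSpace Ω] (P : Measure Ω) [IsProbabilityMeasure P]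
    (ϑ Z : ℕ → Ω → ℝ) (hscheme : N.IsScheme v φ ε x t b P ϑ Z) :
    (∀ᵐ ω ∂P, Tendsto (fun n => ϑ n ω) atTop (𝓝 θε)) ∧
    (θε < N.threshold v →
      (∀ u > 0, DifferentiableOn ℝ (N.meanAt v φ u) (Set.Ioo 0 (N.threshold v))) →
      (∃ g : ℝ → ℝ, TendstoUniformlyOn (fun u => deriv (N.meanAt v φ u)) g atTop
        (Set.Ioo 0 (N.threshold v))) →
      0 < (⨅ θ : Set.Ioo 0 (N.threshold v), |deriv (N.meanLim v φ) θ|) →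
      ∀ ω c κ : ℝ, 1 / 2 < ω → ω ≤ 1 →
        (ω - 1 / 2) / (⨅ θ : Set.Ioo 0 (N.threshold v), |deriv (N.meanLim v φ) θ|) < c →
        (∀ n ≥ 1, b n = c / (n : ℝ) ^ ω) →
        ω - 1 / 2 < κ →
        ((fun n => ⨆ θ : Set.Icc 0 (N.threshold v), |N.meanAt v φ (t n) θ - N.meanLim v φ θ|)
          =o[atTop] fun n : ℕ => (n : ℝ) ^ (-κ)) →
        ∀ η > 0, ∃ M : ℝ, ∀ n : ℕ, 1 ≤ n →
          P {w | M * (n : ℝ) ^ (-(ω - 1 / 2)) < |ϑ n w - θε|} ≤ ENNReal.ofReal η) := by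
  obtain ⟨C, hC⟩ := hφ.bounded
  have hpos : 0 < N.meanLim v φ θε := hθε ▸ hε
  have hmem : θε ∈ Set.Icc 0 (N.subcrit v) := ⟨hθε_nonneg, N.le_subcrit_of_mem_stableSet v hv
    (hφ.mem_stableSet_of_meanLim_pos hv hθε_nonneg hpos)⟩
  have H := hscheme.isProjectedRM hφ hv ht hx hC
  have hconv : ∀ᵐ ω ∂P, Tendsto (fun n => ϑ n ω) atTop (𝓝 θε) := by
    refine H.tendsto_root hmem hb hb_sum hb_sq (fun n hn y hy hyθ => ?_) fun δ hδ => ?_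
    · rw [max_eq_left hy.1, ← hθε]
      exact (hφ.meanLim_anti hy.1 hyθ).trans (hφ.meanLim_le_meanAt (ht n hn).le hy.1)
    · have hup : N.meanLim v φ (θε + δ) < ε :=
        hθε ▸ hφ.meanLim_lt_of_lt hv hθε_nonneg hpos (by linarith)
      have hlow : ∃ η > 0, ∀ y, 0 ≤ y → y ≤ θε - δ → ε + η ≤ N.meanLim v φ y := by
        rcases lt_or_ge (θε - δ) 0 with h | h
        · exact ⟨1, one_pos, fun y hy hyδ => absurd (hyδ.trans_lt h) (not_lt.mpr hy)⟩
        · have hlt : θε - δ < θε := by linarith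
          have h1 := hφ.meanLim_lt_of_lt hv h
            (hpos.trans_le (hφ.meanLim_anti h hlt.le)) hlt
          rw [hθε] at h1
          refine ⟨N.meanLim v φ (θε - δ) - ε, sub_pos.mpr h1, fun y hy hyδ => ?_⟩
          rw [add_sub_cancel]
          exact hφ.meanLim_anti hy hyδ
      obtain ⟨η, hη, hηlow⟩ := hlow
      set η' := (ε - N.meanLim v φ (θε + δ)) / 2
      have hη' : 0 < η' := half_pos (sub_pos.mpr hup)
      -- Convergence at the one point θ_ε + δ suffices: monotonicity in θ carries the bound to all
      -- larger y.
      have hev := ((hφ.tendsto_meanAt (show 0 ≤ θε + δ by linarith)).comp ht_lim).eventually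
        (gt_mem_nhds (show N.meanLim v φ (θε + δ) < ε - η' by simp only [η']; linarith))
      refine ⟨min η η', lt_min hη hη', ?_⟩
      filter_upwards [hev, eventually_ge_atTop 1] with n hn hn1 y hy
      rw [max_eq_left hy.1]
      constructor
      · intro hyδ
        have h1 := hφ.anti (t n) (t n) _ _ (ht n hn1).le le_rfl
          (show 0 ≤ θε + δ by linarith) hyδ
        have h2 : N.meanAt v φ (t n) (θε + δ) < ε - η' := hn
        linarith [min_le_right η η']
      · intro hyδ
        have h1 := hφ.meanLim_le_meanAt (ht n hn1).le hy.1
        linarith [hηlow y hy.1 hyδ, min_le_left η η']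
  refine ⟨hconv, fun hT _ _ hm ω c κ hω hω1 hc hbc hκ hsup η hη => ?_⟩
  set T := N.threshold v
  set m := ⨅ θ : Set.Ioo 0 T, |deriv (N.meanLim v φ) θ|
  have hderiv : ∀ θ ∈ Set.Ioo 0 T, m ≤ |deriv (N.meanLim v φ) θ| := fun θ hθ =>
    ciInf_le (f := fun θ : Set.Ioo 0 T => |deriv (N.meanLim v φ) θ|)
      ⟨0, by rintro _ ⟨θ, rfl⟩; exact abs_nonneg _⟩ ⟨θ, hθ⟩
  refine H.rate (K := 1) hmem hT hconv hω hω1 hm hc hbc hκ.le ?_ hη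
  filter_upwards [hsup.bound one_pos, eventually_ge_atTop 1] with n hn hn1 y hy hyT
  rw [max_eq_left hy.1]
  have hlin : (y - θε) * (N.meanLim v φ y - ε) ≤ -m * (y - θε) ^ 2 := by
    rw [← hθε]
    rcases le_total θε y with h | h
    · have h1 := hφ.meanLim_sub_le hm hderiv hθε_nonneg h hyT
      have h2 := mul_le_mul_of_nonneg_left h1 (sub_nonneg.mpr h)
      linarith
    · have h1 := hφ.meanLim_sub_le hm hderiv hy.1 h hT
      have h2 := mul_le_mul_of_nonneg_left h1 (sub_nonneg.mpr h)
      linarith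
  have hbias : |N.meanAt v φ (t n) y - N.meanLim v φ y| ≤ 1 * (n : ℝ) ^ (-κ) := by
    -- Boundedness is needed for the supremum in the bias hypothesis to dominate its members instead
    -- of being a default value.
    have hbdd : BddAbove (Set.range fun θ : Set.Icc 0 T =>
        |N.meanAt v φ (t n) θ - N.meanLim v φ θ|) := by
      refine ⟨C + C, ?_⟩
      rintro _ ⟨θ, rfl⟩
      refine (abs_sub _ _).trans (add_le_add (N.abs_meanAt_le hC _ _) ?_)
      exact le_of_tendsto (hφ.tendsto_meanAt θ.2.1).abs
        (Eventually.of_forall fun u => N.abs_meanAt_le hC _ _)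
    have h1 := le_ciSup hbdd ⟨y, hy.1, hyT.le⟩
    refine h1.trans ((le_abs_self _).trans ?_)
    rw [Real.norm_eq_abs, Real.norm_of_nonneg (Real.rpow_nonneg (Nat.cast_nonneg n) _)] at hn
    exact hn
  have h3 : (y - θε) * (N.meanAt v φ (t n) y - N.meanLim v φ y)
      ≤ 1 * (n : ℝ) ^ (-κ) * |y - θε| := by
    refine (le_abs_self _).trans ?_
    rw [abs_mul, mul_comm]
    exact mul_le_mul_of_nonneg_right hbias (abs_nonneg _)
  linarith
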